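/- Let $q\in\mathbb C\setminus\{0\}$, $m=N+1\ge 2$, and put $$f(u,v)=\frac{qu-q^{-1}v}{u-v},\qquad g(u,v)=\frac{q-q^{-1}}{u-v},\qquad g^{(r)}(u,v)=v\,g(u,v),$$ $$R(u,v)=f(u,v)\sum_{i}E_{ii}\otimes E_{ii}+\sum_{i<j}(E_{ii}\otimes E_{jj}+E_{jj}\otimes E_{ii})+\sum_{i<j}g(u,v)\,(u\,E_{ij}\otimes E_{ji}+v\,E_{ji}\otimes E_{ij})$$ on $\mathbb C^m\otimes\mathbb C^m$. Let $\mathcal H$ be a complex vector space and let $T(u)=(T_{i,j}(u))_{i,j=1}^{m}$ be a matrix of linear operators on $\mathcal H$ which satisfies $$R(u,v)\,(T(u)\otimes 1)(1\otimes T(v))=(1\otimes T(v))(T(u)\otimes 1)\,R(u,v)$$ for all distinct $u,v$ in a set $S\subset\mathbb C$ (the regular points of the model). Let $|0\rangle\in\mathcal H$ be a pseudovacuum: for $u\in S$, $T_{i,i}(u)|0\rangle=\lambda_i(u)|0\rangle$ for all $i$, and $T_{i,j}(u)|0\rangle=0$ for $i>j$, with scalar functions $\lambda_i$. For finite sets $\bar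 u,\bar v$ write $f(\bar u,\bar v)=\prod_{a\in\bar u,\,b\in\bar v}f(a,b)$ and $\lambda_i(\bar u)=\prod_{a\in\bar u}\lambda_i(a)$; empty products are $1$. The Bethe vector $\mathbb B(\bar t)=\mathbb B(\bar t^1;\dots;\bar t^N)=\mathbb B(\bar t\,|\,T)\in\mathcal H$, where $\bar t^i=\{t^i_1,\dots,t^i_{r_i}\}$, is the one of the nested algebraic Bethe ansatz. For $N=0$ it is $|0\rangle$. For $N\ge1$, with $\bar t^{N+1}=\emptyset$, $$\mathbb B(\bar t\,|\,T)=\frac{1}{\lambda_2(\bar t^1)\,f(\bar t^2,\bar t^1)}\sum_{k_1,\dots,k_{r_1}=2}^{m}T_{1,k_1}(t^1_1)\cdots T_{1,k_{r_1}}(t^1_{r_1})\,\bigl[\mathbb B(\bar t^2;\dots;\bar t^N\,|\,\widetilde T)\bigr]_{k_1,\dots,k_{r_1}}.$$ Here $\widetilde T(u)=D(u)\,\mathsf r_{0,r_1}(u,t^1_{r_1})\cdots\mathsf r_{0,1}(u,t^1_1)$ acts on $\mathcal H\otimes(\mathbb C^{m-1})^{\otimes r_1}$, $D=(T_{i,j})_{i,j=2}^{m}$,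 $\mathsf r$ is the matrix $R$ of size $m-1$ with indices $2,\dots,m$, the pseudovacuum of $\widetilde T$ is $|0\rangle\otimes e_2^{\otimes r_1}$, its vacuum eigenvalues are $\lambda_2(u)f(u,\bar t^1),\lambda_3(u),\dots,\lambda_m(u)$, and $[\,\cdot\,]_{k_1,\dots,k_{r_1}}$ are the components with respect to the standard basis of $(\mathbb C^{m-1})^{\otimes r_1}$. Let $N\ge1$ and let $\bar t^1,\dots,\bar t^{N-1},\{z,\bar t^N\}$ be finite sets of generic parameters: all of them (those of different sets too) lie in $S$ and are pairwise distinct, $f(x,y)\ne0$ for all ordered pairs of different parameters, $\lambda_{i+1}(x)\neq0$ for $x\in\bar t^i$ ($1\le i\le N$), and $\lambda_{N+1}(z)\ne0$. Then $$\mathbb B(\{\bar t^k\}_1^{N-1};\{z,\bar t^N\})=\sum_{j=1}^{N}\frac{T_{j,N+1}(z)}{\lambda_{N+1}(z)}\sum_{\mathrm{part}(\bar t^j,\dots,\bar t^{N-1})}\mathbb B(\{\bar t^k\}_1^{j-1};\{\bar t^k_{\rm II}\}_{j}^{N-1};\bar t^N)\;\frac{\prod_{\nu=j}^{N-1}g^{(r)}(\bar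 t^{\nu+1}_{\rm I},\bar t^{\nu}_{\rm I})\,f(\bar t^{\nu}_{\rm I},\bar t^{\nu}_{\rm II})}{\prod_{\nu=j}^{N}f(\bar t^{\nu}_{\rm I},\bar t^{\nu-1})}.$$ The inner sum runs over all partitions of each $\bar t^\nu$, $\nu=j,\dots,N-1$, into disjoint subsets $\bar t^\nu_{\rm I}$ and $\bar t^\nu_{\rm II}$ with $\#\bar t^\nu_{\rm I}=1$ (it is zero if one of these $\bar t^\nu$ is empty); by definition $\bar t^N_{\rm I}=z$ and $\bar t^0=\emptyset$. The identity holds for every order in which the elements of the sets on the left-hand side are enumerated in the construction of the Bethe vector. -/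

import Mathlib

open scoped Kronecker

/-! ## Rational functions and products over sets of parameters -/

/-- `f(u,v) = (q u - q⁻¹ v) / (u - v)`. -/
noncomputable def fFun (q u v : ℂ) : ℂ := (q * u - q⁻¹ * v) / (u - v)

/-- `g(u,v) = (q - q⁻¹) / (u - v)`. -/
noncomputable def gFun (q u v : ℂ) : ℂ := (q - q⁻¹) / (u - v)

/-- `g^{(r)}(u,v) = v g(u,v)`. -/
noncomputable def gRight (q u v : ℂ) : ℂ := v * gFun q u v

/-- Product of a one-variable function over a set of parameters, given as a list. -/
noncomputable def prodOver (φ : ℂ → ℂ) (x : List ℂ) : ℂ := (x.map φ).prod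

/-- Double product `f(x, y)` over two sets of parameters; it is `1` if one of them is empty. -/
noncomputable def fProd (q : ℂ) (x y : List ℂ) : ℂ :=
  prodOver (fun u => prodOver (fun v => fFun q u v) y) x

/-! ## The `R`-matrix and quantum integrable models -/

/-- The trigonometric `R`-matrix on `ℂ^m ⊗ ℂ^m`. -/
noncomputable def rMatrix (m : ℕ) (q u v : ℂ) : Matrix (Fin m × Fin m) (Fin m × Fin m) ℂ :=
  let E : Fin m → Fin m → Matrix (Fin m) (Fin m) ℂ := fun i j => Matrix.single i j 1
  fFun q u v • ∑ i, E i i ⊗ₖ E i i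
    + ∑ i, ∑ j ∈ Finset.Ioi i, (E i i ⊗ₖ E j j + E j j ⊗ₖ E i i)
    + ∑ i, ∑ j ∈ Finset.Ioi i,
        gFun q u v • (u • (E i j ⊗ₖ E j i) + v • (E j i ⊗ₖ E i j))

/-- `T` satisfies the relation
`R(u,v) (T(u) ⊗ 1) (1 ⊗ T(v)) = (1 ⊗ T(v)) (T(u) ⊗ 1) R(u,v)` for `u ≠ v` in `S`, the set of
points at which the monodromy matrix is regular. -/
def IsMonodromy {m : ℕ} {H : Type*} [AddCommGroup H] [Module ℂ H] (q : ℂ) (S : Set ℂ)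
    (T : ℂ → Matrix (Fin m) (Fin m) (Module.End ℂ H)) : Prop :=
  ∀ u ∈ S, ∀ v ∈ S, u ≠ v →
    (rMatrix m q u v).map (algebraMap ℂ (Module.End ℂ H))
        * (T u ⊗ₖ (1 : Matrix (Fin m) (Fin m) (Module.End ℂ H)))
        * ((1 : Matrix (Fin m) (Fin m) (Module.End ℂ H)) ⊗ₖ T v)
      = ((1 : Matrix (Fin m) (Fin m) (Module.End ℂ H)) ⊗ₖ T v)
        * (T u ⊗ₖ (1 : Matrix (Fin m) (Fin m) (Module.End ℂ H)))
        * (rMatrix m q u v).map (algebraMap ℂ (Module.End ℂ H))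

/-- `vac` is a pseudovacuum vector of `T` with vacuum eigenvalues `lam`. -/
def IsPseudovacuum {m : ℕ} {H : Type*} [AddCommGroup H] [Module ℂ H] (S : Set ℂ)
    (T : ℂ → Matrix (Fin m) (Fin m) (Module.End ℂ H)) (lam : Fin m → ℂ → ℂ) (vac : H) : Prop :=
  ∀ u ∈ S, (∀ i, T u i i vac = lam i u • vac) ∧ ∀ i j, j < i → T u i j vac = 0

/-! ## The nested algebraic Bethe ansatz

The space `H ⊗ (ℂ^n)^{⊗ r}` is modelled by the functions `(Fin r → Fin n) → H`: such a function
lists the components of a vector with respect to the standard basis of `(ℂ^n)^{⊗ r}`. -/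

/-- The `R`-matrix `R_{0,s}(u, ξ)`, as a matrix in the auxiliary space `0` whose entries act on the
`s`-th copy of `ℂ^n` in `H ⊗ (ℂ^n)^{⊗ r}`. -/
noncomputable def siteR (H : Type*) [AddCommGroup H] [Module ℂ H] (n : ℕ) {r : ℕ} (q u ξ : ℂ)
    (s : Fin r) : Matrix (Fin n) (Fin n) (Module.End ℂ ((Fin r → Fin n) → H)) :=
  Matrix.of fun i j => LinearMap.pi fun k =>
    ∑ b, rMatrix n q u ξ (i, k s) (j, b) • LinearMap.proj (Function.update k s b)

/-- The monodromy matrix `D(u) R_{0,r}(u, x_r) ⋯ R_{0,1}(u, x_1)` on `H ⊗ (ℂ^n)^{⊗ r}`, where `D`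
is the lower right `n × n` block of `T`. -/
noncomputable def nestedMonodromy {H : Type*} [AddCommGroup H] [Module ℂ H] {n : ℕ} (q : ℂ)
    (T : ℂ → Matrix (Fin (n + 1)) (Fin (n + 1)) (Module.End ℂ H)) (x : List ℂ) (u : ℂ) :
    Matrix (Fin n) (Fin n) (Module.End ℂ ((Fin x.length → Fin n) → H)) :=
  (Matrix.of fun i j => (T u i.succ j.succ).compLeft (Fin x.length → Fin n))
    * (List.ofFn fun s : Fin x.length => siteR H n q u (x.get s) s).reverse.prod

/-- The vacuum eigenvalues of the nested monodromy matrix: the first one is `λ_2(u) f(u, x)`, the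
other ones are `λ_3, λ_4, …`. -/
noncomputable def nestedLam {n : ℕ} (q : ℂ) (lam : Fin (n + 2) → ℂ → ℂ) (x : List ℂ) :
    Fin (n + 1) → ℂ → ℂ :=
  Fin.cons (fun u => lam 1 u * fProd q [u] x) fun i => lam i.succ.succ

/-- The nested pseudovacuum `vac ⊗ e_1 ⊗ ⋯ ⊗ e_1`. -/
noncomputable def nestedVac {H : Type*} [AddCommGroup H] (n r : ℕ) (vac : H) :
    (Fin r → Fin (n + 1)) → H :=
  Pi.single (fun _ => 0) vac

/-- The Bethe vector `𝔹(t^1, …, t^N)` of the monodromy matrix `T` of size `N + 1`, normalised by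
the vacuum eigenvalues `lam`, as it is built by the nested algebraic Bethe ansatz:
`𝔹(t | T) = ∑_k T_{1,k_1}(t^1_1) ⋯ T_{1,k_r}(t^1_r) [𝔹(t^2, …, t^N | T')]_k`
divided by `λ_2(t^1) f(t^2, t^1)`, where `r` is the size of `t^1`, `T'` is the nested monodromy
matrix and `t^{N+1}` is empty. The colour `i` and the index `i` of `T` are both counted
from `0` in the code. -/
noncomputable def betheVector (q : ℂ) : (N : ℕ) → {H : Type*} → [AddCommGroup H] → [Module ℂ H] →
    (ℂ → Matrix (Fin (N + 1)) (Fin (N + 1)) (Module.End ℂ H)) → (Fin (N + 1) → ℂ → ℂ) → H →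
    (Fin N → List ℂ) → H
  | 0, _, _, _, _, _, vac, _ => vac
  | N + 1, _, _, _, T, lam, vac, t =>
    let x := t 0
    let y := (Fin.snoc t [] : Fin (N + 2) → List ℂ) 1
    let ψ := betheVector q N (nestedMonodromy q T x) (nestedLam q lam x)
      (nestedVac N x.length vac) fun i => t i.succ
    (prodOver (lam 1) x * fProd q y x)⁻¹ •
      ∑ k : Fin x.length → Fin (N + 1),
        (List.ofFn fun s : Fin x.length => T (x.get s) 0 (k s).succ).prod (ψ k)

/-! ## Generic parameters and partitions -/

/-- Generic Bethe parameters: they are regular points of the model, they are pairwise distinct,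
`f` does not vanish on pairs of them, and the eigenvalues `λ_{i+1}(t^i)` by which Bethe vectors are
normalised do not vanish. -/
def IsGeneric {N : ℕ} (q : ℂ) (S : Set ℂ) (lam : Fin (N + 1) → ℂ → ℂ) (t : Fin N → List ℂ) : Prop :=
  (∀ i, ∀ x ∈ t i, x ∈ S ∧ lam i.succ x ≠ 0) ∧
    (List.ofFn t).flatten.Pairwise fun x y => x ≠ y ∧ fFun q x y ≠ 0 ∧ fFun q y x ≠ 0

/-- The parameters `t^1, …, t^{N-1}, {z, t^N}`. -/
def addLast {n : ℕ} (t : Fin (n + 1) → List ℂ) (z : ℂ) : Fin (n + 1) → List ℂ :=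
  Function.update t (Fin.last n) (z :: t (Fin.last n))

/-- A partition of each of the sets `t^j, …, t^{N-1}` into a one-element subset and its complement:
the choice of (the position of) one element in each of these sets. -/
abbrev ParamPartition {n : ℕ} (t : Fin (n + 1) → List ℂ) (j : Fin (n + 1)) : Type :=
  (ν : {ν : Fin (n + 1) // j ≤ ν ∧ ν < Fin.last n}) → Fin (t ν).length

/-- The only element of the first part of `t^ν`, for `j ≤ ν < N`; it is `z` for `ν = N`
(the value for `ν < j` plays no role). -/
def partI {n : ℕ} {t : Fin (n + 1) → List ℂ} {j : Fin (n + 1)} (z : ℂ) (p : ParamPartition t j)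
    (ν : Fin (n + 1)) : ℂ :=
  if h : j ≤ ν ∧ ν < Fin.last n then (t ν).get (p ⟨ν, h⟩) else z

/-- The second part of `t^ν`, for `j ≤ ν < N`; the whole set `t^ν` for the other `ν`. -/
def partII {n : ℕ} {t : Fin (n + 1) → List ℂ} {j : Fin (n + 1)} (p : ParamPartition t j)
    (ν : Fin (n + 1)) : List ℂ :=
  if h : j ≤ ν ∧ ν < Fin.last n then (t ν).eraseIdx (p ⟨ν, h⟩) else t ν

/-- The coefficient
`∏_{ν=j}^{N-1} g^{(r)}(t^{ν+1}_I, t^ν_I) f(t^ν_I, t^ν_II) / ∏_{ν=j}^{N} f(t^ν_I, t^{ν-1})`,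
where `t^0` is empty. -/
noncomputable def recCoeff {n : ℕ} {t : Fin (n + 1) → List ℂ} {j : Fin (n + 1)} (q z : ℂ)
    (p : ParamPartition t j) : ℂ :=
  (∏ ν : Fin n with j ≤ ν.castSucc,
      gRight q (partI z p ν.succ) (partI z p ν.castSucc)
        * fProd q [partI z p ν.castSucc] (partII p ν.castSucc))
    / ∏ ν ∈ Finset.Ici j,
        fProd q [partI z p ν] ((Fin.cons [] fun i : Fin n => t i.castSucc : Fin (n + 1) → List ℂ) ν)

/-! The argument runs on the vectors `bHat` without normalisation and is an induction on the number
of colours. The nested vector is itself a Bethe vector, for the smaller monodromy matrix `chain`, so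
the inductive hypothesis extracts `z` from it as an entry of the last column of that matrix at `z`.
This entry then has to be carried to the left through the first-row operators (`bRow_chain`). The
exchange relations give a term in which the entry has become an entry of `T z` outside the first
row: these are all summands of the recursion except the first. They also give terms with the corner
entry of `T z` in which one parameter `ξ` of the first set has lost its operator; these must add up
to the first summand.

To evaluate them, the site of `ξ` is moved to the outer end of the chain by `extract`. The RTT
relation shows that this map intertwines the chain with `R(u, ξ)` times the chain without that site
(`extract_intertwine`). Since Bethe vectors are natural under intertwiners (`bHat_intertwine`), the
nested vector becomes one for a model with an additional site, and its components are computed by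
`bHat_leftR_apply`: one parameter is removed from each of the first few sets. For every `j` there is
now a sum over elements removed from the sets before `j` (by the additional site) and from `j` on
(by the inductive hypothesis). The sum over `j` collapses by a rational identity
(`sum_recSum_evSum`), and the factor it leaves behind turns `g^{(r)}(z, ξ)` into `g^{(r)}(y, ξ)`,
with `y` the element chosen in the next set.

Independence of the enumeration (`bHat_perm`) follows from the same naturality, the intertwiner
being the normalised `R`-matrix. The stated coefficients come from splitting the normalisation
factor along a partition (`bNorm_addLast`). -/

/-! ### Entries of the `R`-matrix -/

/-- Diagonal entries of the `R`-matrix. -/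
noncomputable def rDiag {m : ℕ} (q u v : ℂ) (i k : Fin m) : ℂ := if i = k then fFun q u v else 1

/-- Entries of the `R`-matrix that exchange two indices. -/
noncomputable def rSwap {m : ℕ} (q u v : ℂ) (i k : Fin m) : ℂ :=
  if i < k then u * gFun q u v else if k < i then v * gFun q u v else 0

/-- For `i = k` the two index patterns coincide; `rSwap` vanishes there, so that `f` is counted
once. -/
theorem rMatrix_apply (m : ℕ) (q u v : ℂ) (i k j l : Fin m) :
    rMatrix m q u v (i, k) (j, l) =
      (if i = j ∧ k = l then rDiag q u v i k else 0)
        + (if i = l ∧ k = j then rSwap q u v i k else 0) := by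
  have h1 : (∑ a : Fin m, (if a = i ∧ a = j then (1 : ℂ) else 0) * if a = k ∧ a = l then 1 else 0)
      = if i = j ∧ k = l ∧ i = k then 1 else 0 := by
    rw [Finset.sum_eq_single i]
    · by_cases h : i = k <;> by_cases h' : i = j <;> by_cases h'' : k = l <;> simp_all
    · intro b _ hb; simp [hb]
    · simp
  have key : ∀ (F : Fin m → Fin m → ℂ) (a₀ b₀ : Fin m),
      (∀ a b, a < b → F a b ≠ 0 → a = a₀ ∧ b = b₀) →
      ∑ a, ∑ b ∈ Finset.Ioi a, F a b = if a₀ < b₀ then F a₀ b₀ else 0 := by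
    intro F a₀ b₀ h
    rw [Finset.sum_eq_single a₀]
    · split_ifs with hab
      · rw [Finset.sum_eq_single b₀]
        · intro b hb hne
          by_contra hF
          exact hne (h _ _ (Finset.mem_Ioi.1 hb) hF).2
        · intro hb; exact absurd (Finset.mem_Ioi.2 hab) hb
      · refine Finset.sum_eq_zero fun b hb => ?_
        by_contra hF
        have := (h _ _ (Finset.mem_Ioi.1 hb) hF).2
        subst this
        exact hab (Finset.mem_Ioi.1 hb)
    · intro a _ hne
      refine Finset.sum_eq_zero fun b hb => ?_
      by_contra hF
      exact hne (h _ _ (Finset.mem_Ioi.1 hb) hF).1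
    · simp
  simp only [rMatrix, Matrix.add_apply, Matrix.smul_apply, Matrix.sum_apply,
    Matrix.kroneckerMap_apply, Matrix.single_apply, smul_eq_mul, mul_add, Finset.sum_add_distrib]
  rw [h1]
  rw [key _ i k, key _ k i, key _ i k, key _ k i]
  · rcases lt_trichotomy i k with h | h | h
    · simp only [h, h.not_gt, h.ne, rDiag, rSwap, if_true, if_false, true_and, and_false, mul_zero,
        zero_add, add_zero]
      grind
    · subst h
      simp only [lt_irrefl, rDiag, rSwap, if_true, if_false, and_true, add_zero, ite_self]
      by_cases a1 : i = j <;> by_cases a2 : i = l <;> simp [a1, a2]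
    · simp only [h, h.not_gt, h.ne', rDiag, rSwap, if_true, if_false, true_and, and_false, mul_zero,
        zero_add]
      grind
  all_goals
    intro a b _ hF
    by_contra hab
    apply hF
    simp only [not_and_or] at hab
    rcases hab with hab | hab <;> simp [hab]

/-! ### Sums against the `R`-matrix and the Yang–Baxter equation -/

section sums
variable {M : Type*} [AddCommGroup M] [Module ℂ M]

theorem sum_rMatrix_row {m : ℕ} (q u v : ℂ) (i k : Fin m) (X : Fin m → Fin m → M) :
    ∑ a, ∑ b, rMatrix m q u v (i, k) (a, b) • X a b
      = rDiag q u v i k • X i k + rSwap q u v i k • X k i := by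
  simp only [rMatrix_apply, add_smul, Finset.sum_add_distrib, ite_and, ite_smul, zero_smul]
  simp

theorem sum_rMatrix_col {m : ℕ} (q u v : ℂ) (j l : Fin m) (X : Fin m → Fin m → M) :
    ∑ a, ∑ b, rMatrix m q u v (a, b) (j, l) • X a b
      = rDiag q u v j l • X j l + rSwap q u v l j • X l j := by
  have h1 : ∀ a b : Fin m, (a = j ∧ b = l) ↔ (j = a ∧ l = b) := by intros; constructor <;> simp +contextual
  have h2 : ∀ a b : Fin m, (a = l ∧ b = j) ↔ (l = a ∧ j = b) := by intros; constructor <;> simp +contextual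
  simp only [rMatrix_apply, h1, h2, add_smul, Finset.sum_add_distrib, ite_and, ite_smul, zero_smul]
  simp

/-- The Yang–Baxter equation, applied to a vector `X` of `(ℂ^m)^{⊗ 3}` with coefficients in `M`. -/
theorem yangBaxter_apply {m : ℕ} {q : ℂ} (hq : q ≠ 0) {u v w : ℂ} (huv : u ≠ v) (huw : u ≠ w) (hvw : v ≠ w)
    (i k p : Fin m) (X : Fin m → Fin m → Fin m → ℂ) :
    ∑ a, ∑ b, rMatrix m q u v (i, k) (a, b) * ∑ j, ∑ c, rMatrix m q u w (a, p) (j, c) *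
        ∑ l, ∑ d, rMatrix m q v w (b, c) (l, d) * X j l d
      = ∑ b, ∑ c, rMatrix m q v w (k, p) (b, c) * ∑ a, ∑ d, rMatrix m q u w (i, c) (a, d) *
        ∑ j, ∑ l, rMatrix m q u v (a, b) (j, l) * X j l d := by
  simp only [← smul_eq_mul]
  simp only [sum_rMatrix_row]
  simp only [smul_eq_mul]
  have huv' := sub_ne_zero.2 huv
  have huw' := sub_ne_zero.2 huw
  have hvw' := sub_ne_zero.2 hvw
  -- Both sides combine values of `X` at permutations of `(i, k, p)`, with coefficients that depend
  -- only on the relative order of these indices. In each order the equality is a rational identity.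
  rcases lt_trichotomy i k with h1 | h1 | h1 <;> rcases lt_trichotomy k p with h2 | h2 | h2 <;>
    rcases lt_trichotomy i p with h3 | h3 | h3 <;> first | (exfalso; omega) | skip
  all_goals
    try subst h1
    try subst h2
    try subst h3
    simp only [rDiag, rSwap, lt_irrefl, if_true, if_false, ne_of_lt, ne_of_gt,
      not_lt_of_gt, *]
    simp only [fFun, gFun]
    field_simp
    try ring
end sums

/-! ### Exchange relations in components -/

section monodromy
variable {m : ℕ} {H : Type*} [AddCommGroup H] [Module ℂ H]

theorem isMonodromy_iff {q : ℂ} {S : Set ℂ} {T : ℂ → Matrix (Fin m) (Fin m) (Module.End ℂ H)} :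
    IsMonodromy q S T ↔ ∀ u ∈ S, ∀ v ∈ S, u ≠ v → ∀ i k j l h,
      ∑ a, ∑ b, rMatrix m q u v (i, k) (a, b) • T u a j (T v b l h)
        = ∑ a, ∑ b, rMatrix m q u v (a, b) (j, l) • T v k b (T u i a h) := by
  have key : ∀ u v, ((rMatrix m q u v).map (algebraMap ℂ (Module.End ℂ H))
        * (T u ⊗ₖ (1 : Matrix (Fin m) (Fin m) (Module.End ℂ H)))
        * ((1 : Matrix (Fin m) (Fin m) (Module.End ℂ H)) ⊗ₖ T v)
      = ((1 : Matrix (Fin m) (Fin m) (Module.End ℂ H)) ⊗ₖ T v)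
        * (T u ⊗ₖ (1 : Matrix (Fin m) (Fin m) (Module.End ℂ H)))
        * (rMatrix m q u v).map (algebraMap ℂ (Module.End ℂ H))) ↔ ∀ i k j l h,
      ∑ a, ∑ b, rMatrix m q u v (i, k) (a, b) • T u a j (T v b l h)
        = ∑ a, ∑ b, rMatrix m q u v (a, b) (j, l) • T v k b (T u i a h) := by
    intro u v
    have e1 : ∀ i k j l h, (((rMatrix m q u v).map (algebraMap ℂ (Module.End ℂ H))
        * (T u ⊗ₖ (1 : Matrix (Fin m) (Fin m) (Module.End ℂ H)))
        * ((1 : Matrix (Fin m) (Fin m) (Module.End ℂ H)) ⊗ₖ T v)) (i, k) (j, l)) h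
        = ∑ a, ∑ b, rMatrix m q u v (i, k) (a, b) • T u a j (T v b l h) := by
      intro i k j l h
      rw [mul_assoc, Matrix.mul_apply]
      simp only [Fintype.sum_prod_type, LinearMap.sum_apply,
        Matrix.map_apply, Module.End.mul_apply, Module.algebraMap_end_apply]
      refine Finset.sum_congr rfl fun a _ => Finset.sum_congr rfl fun b _ => ?_
      congr 1
      simp [Matrix.mul_apply, Fintype.sum_prod_type, Matrix.kroneckerMap_apply, Matrix.one_apply,
        Finset.sum_ite_eq]
    have e2 : ∀ i k j l h, (((1 : Matrix (Fin m) (Fin m) (Module.End ℂ H)) ⊗ₖ T v)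
        * (T u ⊗ₖ (1 : Matrix (Fin m) (Fin m) (Module.End ℂ H)))
        * (rMatrix m q u v).map (algebraMap ℂ (Module.End ℂ H))) (i, k) (j, l) h
        = ∑ a, ∑ b, rMatrix m q u v (a, b) (j, l) • T v k b (T u i a h) := by
      intro i k j l h
      rw [Matrix.mul_apply]
      simp only [Fintype.sum_prod_type, LinearMap.sum_apply,
        Matrix.map_apply, Module.End.mul_apply, Module.algebraMap_end_apply, map_smul]
      refine Finset.sum_congr rfl fun a _ => Finset.sum_congr rfl fun b _ => ?_
      congr 1
      simp [Matrix.mul_apply, Fintype.sum_prod_type, Matrix.kroneckerMap_apply, Matrix.one_apply,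
        Finset.sum_ite_eq]
    constructor
    · intro h i k j l w
      rw [← e1, ← e2, h]
    · intro h
      ext ⟨i, k⟩ ⟨j, l⟩ w
      rw [e1, e2, h]
  unfold IsMonodromy
  simp only [key]

/-- The exchange relation of a monodromy matrix in components. -/
theorem IsMonodromy.exchange {q : ℂ} {S : Set ℂ} {T : ℂ → Matrix (Fin m) (Fin m) (Module.End ℂ H)}
    (hT : IsMonodromy q S T) {u v : ℂ} (hu : u ∈ S) (hv : v ∈ S) (huv : u ≠ v)
    (i k j l : Fin m) (h : H) :
    rDiag q u v i k • T u i j (T v k l h) + rSwap q u v i k • T u k j (T v i l h)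
      = rDiag q u v j l • T v k l (T u i j h) + rSwap q u v l j • T v k j (T u i l h) := by
  have := isMonodromy_iff.1 hT u hu v hv huv i k j l h
  rwa [sum_rMatrix_row q u v i k fun a b => T u a j (T v b l h),
    sum_rMatrix_col q u v j l fun a b => T v k b (T u i a h)] at this

/-- The lower right block of a matrix of operators. -/
def block {n : ℕ} {E : Type*} (T : ℂ → Matrix (Fin (n + 1)) (Fin (n + 1)) E) (u : ℂ) :
    Matrix (Fin n) (Fin n) E :=
  Matrix.of fun i j => T u i.succ j.succ

theorem rDiag_succ (q u v : ℂ) (i k : Fin m) : rDiag q u v i.succ k.succ = rDiag q u v i k := by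
  simp [rDiag]

theorem rSwap_succ (q u v : ℂ) (i k : Fin m) : rSwap q u v i.succ k.succ = rSwap q u v i k := by
  simp [rSwap]

/-- The `R`-matrix only permutes a pair of indices, and its entries depend only on their order. The
relations among entries of the lower right block therefore close, with the smaller `R`-matrix. -/
theorem isMonodromy_block {q : ℂ} {S : Set ℂ}
    {T : ℂ → Matrix (Fin (m + 1)) (Fin (m + 1)) (Module.End ℂ H)} (hT : IsMonodromy q S T) :
    IsMonodromy q S (block T) := by
  rw [isMonodromy_iff]
  intro u hu v hv huv i k j l h
  rw [sum_rMatrix_row q u v i k fun a b => block T u a j (block T v b l h),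
    sum_rMatrix_col q u v j l fun a b => block T v k b (block T u i a h)]
  have := hT.exchange hu hv huv i.succ k.succ j.succ l.succ h
  rw [rDiag_succ, rDiag_succ, rSwap_succ, rSwap_succ] at this
  exact this

end monodromy

/-! ### Chains of `R`-matrices, one site at a time -/

section chain
variable {n : ℕ} {H : Type*} [AddCommGroup H] [Module ℂ H]

/-- The monodromy matrix `D(u) R_{0,r}(u, x_r) ⋯ R_{0,1}(u, x_1)`. -/
noncomputable def chain (q : ℂ) (D : ℂ → Matrix (Fin n) (Fin n) (Module.End ℂ H)) (x : List ℂ)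
    (u : ℂ) : Matrix (Fin n) (Fin n) (Module.End ℂ ((Fin x.length → Fin n) → H)) :=
  (Matrix.of fun i j => (D u i j).compLeft (Fin x.length → Fin n))
    * (List.ofFn fun s : Fin x.length => siteR H n q u (x.get s) s).reverse.prod

theorem nestedMonodromy_eq_chain (q : ℂ)
    (T : ℂ → Matrix (Fin (n + 1)) (Fin (n + 1)) (Module.End ℂ H)) (x : List ℂ) :
    nestedMonodromy q T x = chain q (block T) x := rfl

/-- The components of a vector with the index of the first site fixed. -/
def slice {r : ℕ} (k : Fin n) :
    ((Fin (r + 1) → Fin n) → H) →ₗ[ℂ] ((Fin r → Fin n) → H) :=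
  LinearMap.funLeft ℂ H fun κ => Fin.cons k κ

theorem slice_apply {r : ℕ} (k : Fin n) (ψ : (Fin (r + 1) → Fin n) → H) (κ : Fin r → Fin n) :
    slice k ψ κ = ψ (Fin.cons k κ) := rfl

theorem ext_slice {r : ℕ} {ψ φ : (Fin (r + 1) → Fin n) → H} (h : ∀ k, slice k ψ = slice k φ) :
    ψ = φ := by
  ext κ
  have := congrFun (h (κ 0)) (Fin.tail κ)
  simpa only [slice_apply, Fin.cons_self_tail] using this

/-- The vector with prescribed slices. -/
def unslice {r : ℕ} {W : Type*} [AddCommGroup W] [Module ℂ W]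
    (F : Fin n → W →ₗ[ℂ] ((Fin r → Fin n) → H)) : W →ₗ[ℂ] ((Fin (r + 1) → Fin n) → H) :=
  LinearMap.pi fun κ => LinearMap.proj (Fin.tail κ) ∘ₗ F (κ 0)

theorem slice_unslice {r : ℕ} {W : Type*} [AddCommGroup W] [Module ℂ W]
    (F : Fin n → W →ₗ[ℂ] ((Fin r → Fin n) → H)) (k : Fin n) (w : W) :
    slice k (unslice F w) = F k w := by
  ext κ
  simp [slice_apply, unslice]

theorem chain_nil (q : ℂ) (D : ℂ → Matrix (Fin n) (Fin n) (Module.End ℂ H)) (u : ℂ) (i j : Fin n)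
    (ψ : (Fin ([] : List ℂ).length → Fin n) → H) (κ : Fin ([] : List ℂ).length → Fin n) :
    chain q D [] u i j ψ κ = D u i j (ψ κ) := by
  simp [chain, LinearMap.compLeft_apply]

theorem mul_intertwine {W W' : Type*} [AddCommGroup W] [Module ℂ W] [AddCommGroup W'] [Module ℂ W']
    (L : W →ₗ[ℂ] W') {A B : Matrix (Fin n) (Fin n) (Module.End ℂ W)}
    {A' B' : Matrix (Fin n) (Fin n) (Module.End ℂ W')}
    (hA : ∀ i j w, L (A i j w) = A' i j (L w)) (hB : ∀ i j w, L (B i j w) = B' i j (L w))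
    (i j : Fin n) (w : W) : L ((A * B) i j w) = (A' * B') i j (L w) := by
  simp [Matrix.mul_apply, LinearMap.sum_apply, hA, hB]

theorem prod_intertwine {W W' : Type*} [AddCommGroup W] [Module ℂ W] [AddCommGroup W']
    [Module ℂ W'] (L : W →ₗ[ℂ] W') {r : ℕ} {A : Fin r → Matrix (Fin n) (Fin n) (Module.End ℂ W)}
    {A' : Fin r → Matrix (Fin n) (Fin n) (Module.End ℂ W')}
    (hA : ∀ s i j w, L (A s i j w) = A' s i j (L w)) (i j : Fin n) (w : W) :
    L ((List.ofFn A).reverse.prod i j w) = (List.ofFn A').reverse.prod i j (L w) := by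
  induction r generalizing i j w with
  | zero => by_cases h : i = j <;> simp [h]
  | succ r ih =>
    simp only [List.ofFn_succ, List.reverse_cons, List.prod_append, List.prod_singleton]
    exact mul_intertwine L (ih fun s => hA s.succ) (hA 0) i j w

theorem slice_siteR_zero {r : ℕ} (q u a : ℂ) (i j k : Fin n) (ψ : (Fin (r + 1) → Fin n) → H) :
    slice k (siteR H n q u a 0 i j ψ) = ∑ b, rMatrix n q u a (i, k) (j, b) • slice b ψ := by
  ext κ
  simp [slice_apply, siteR, Finset.sum_apply]

theorem slice_siteR_succ {r : ℕ} (q u a : ℂ) (s : Fin r) (i j k : Fin n)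
    (ψ : (Fin (r + 1) → Fin n) → H) :
    slice k (siteR H n q u a s.succ i j ψ) = siteR H n q u a s i j (slice k ψ) := by
  ext κ
  simp [slice_apply, siteR, Finset.sum_apply, Fin.cons_update]

/-- The first site occurs only in the rightmost factor of the product; all other factors commute
with fixing its index. This makes induction on the list of sites possible. -/
theorem chain_cons (q : ℂ) (D : ℂ → Matrix (Fin n) (Fin n) (Module.End ℂ H)) (a : ℂ) (x : List ℂ)
    (u : ℂ) (i j k : Fin n) (ψ : (Fin (x.length + 1) → Fin n) → H) :
    slice k (chain q D (a :: x) u i j ψ)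
      = ∑ l, ∑ b, rMatrix n q u a (l, k) (j, b) • chain q D x u i l (slice b ψ) := by
  have h : chain q D (a :: x) u =
      ((Matrix.of fun i j => (D u i j).compLeft (Fin (a :: x).length → Fin n))
        * (List.ofFn fun s : Fin x.length =>
            siteR H n (r := x.length + 1) q u (x.get s) s.succ).reverse.prod)
        * siteR H n (r := x.length + 1) q u a 0 := by
    simp only [chain, List.length_cons, List.ofFn_succ, List.reverse_cons, List.prod_append,
      List.prod_singleton, mul_assoc]
    rfl
  rw [h, Matrix.mul_apply, LinearMap.sum_apply, map_sum]
  refine Finset.sum_congr rfl fun l _ => ?_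
  rw [Module.End.mul_apply]
  have key := mul_intertwine (n := n) (slice (H := H) (r := x.length) k)
    (A := Matrix.of fun i j => (D u i j).compLeft (Fin (x.length + 1) → Fin n))
    (A' := Matrix.of fun i j => (D u i j).compLeft (Fin x.length → Fin n))
    (fun i j w => rfl)
    (prod_intertwine (slice (H := H) (r := x.length) k)
      (A := fun s : Fin x.length => siteR H n (r := x.length + 1) q u (x.get s) s.succ)
      (A' := fun s : Fin x.length => siteR H n q u (x.get s) s)
      fun s i j w => slice_siteR_succ q u _ s i j k w)
  refine (key i l _).trans ?_
  rw [slice_siteR_zero, map_sum]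
  simp only [map_smul]
  rfl

/-- Operators that intertwine two matrices also intertwine the chains built on them. -/
theorem chain_intertwine {H' : Type*} [AddCommGroup H'] [Module ℂ H'] (q : ℂ)
    {D : ℂ → Matrix (Fin n) (Fin n) (Module.End ℂ H)}
    {D' : ℂ → Matrix (Fin n) (Fin n) (Module.End ℂ H')} (L : H →ₗ[ℂ] H') {u : ℂ}
    (h : ∀ i j w, L (D u i j w) = D' u i j (L w)) (x : List ℂ) (i j : Fin n)
    (ψ : (Fin x.length → Fin n) → H) :
    L.compLeft _ (chain q D x u i j ψ) = chain q D' x u i j (L.compLeft _ ψ) := by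
  refine mul_intertwine (L.compLeft (Fin x.length → Fin n)) ?_ ?_ i j ψ
  · intro i j w
    ext κ
    simp [LinearMap.compLeft_apply, h]
  · refine prod_intertwine _ ?_
    intro s i j w
    ext κ
    simp [LinearMap.compLeft_apply, siteR]

end chain

/-- The Yang–Baxter equation in components. -/
theorem yangBaxter {m : ℕ} {q : ℂ} (hq : q ≠ 0) {u v w : ℂ} (huv : u ≠ v) (huw : u ≠ w)
    (hvw : v ≠ w) (i k p j l d : Fin m) :
    ∑ a, ∑ b, ∑ c, rMatrix m q u v (i, k) (a, b) *
        (rMatrix m q u w (a, p) (j, c) * rMatrix m q v w (b, c) (l, d))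
      = ∑ b, ∑ c, ∑ a, rMatrix m q v w (k, p) (b, c) *
        (rMatrix m q u w (i, c) (a, d) * rMatrix m q u v (a, b) (j, l)) := by
  -- The matrix form is the vector form tested on the basis vector with indices `j`, `l`, `d`.
  have h := yangBaxter_apply hq huv huw hvw i k p
    fun j' l' d' => if j' = j then (if l' = l then (if d' = d then 1 else 0) else 0) else 0
  simp only [mul_ite, mul_one, mul_zero, Finset.sum_ite_eq', Finset.mem_univ, if_true,
    Finset.sum_ite_irrel, Finset.sum_const_zero, Finset.mul_sum] at h
  exact h

section chain
variable {n : ℕ} {H : Type*} [AddCommGroup H] [Module ℂ H]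

/-- This and the next two lemmas only reorder six-fold sums, bringing the coefficients into the
shape in which the Yang–Baxter equation applies. -/
theorem sum_six_left {M : Type*} [AddCommGroup M] [Module ℂ M] (r₁ r₂ : Fin n → Fin n → ℂ)
    (r₃ : Fin n → Fin n → Fin n → ℂ) (X : Fin n → Fin n → Fin n → Fin n → Fin n → M) :
    ∑ a, ∑ b, r₁ a b • ∑ c, ∑ β, r₂ c β • ∑ d, ∑ e, r₃ d β e • X a b c d e
      = ∑ e, ∑ c, ∑ d, ∑ β, (r₂ c β * r₃ d β e) • ∑ a, ∑ b, r₁ a b • X a b c d e := by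
  have h1 : ∑ a, ∑ b, r₁ a b • ∑ c, ∑ β, r₂ c β • ∑ d, ∑ e, r₃ d β e • X a b c d e =
      ∑ t : Fin n × Fin n × Fin n × Fin n × Fin n × Fin n,
        (r₁ t.1 t.2.1 * (r₂ t.2.2.1 t.2.2.2.1 * r₃ t.2.2.2.2.1 t.2.2.2.1 t.2.2.2.2.2)) •
          X t.1 t.2.1 t.2.2.1 t.2.2.2.2.1 t.2.2.2.2.2 := by
    simp only [Fintype.sum_prod_type, Finset.smul_sum, smul_smul]
  have h2 : ∑ e, ∑ c, ∑ d, ∑ β, (r₂ c β * r₃ d β e) • ∑ a, ∑ b, r₁ a b • X a b c d e =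
      ∑ t : Fin n × Fin n × Fin n × Fin n × Fin n × Fin n,
        ((r₂ t.2.1 t.2.2.2.1 * r₃ t.2.2.1 t.2.2.2.1 t.1) * r₁ t.2.2.2.2.1 t.2.2.2.2.2) •
          X t.2.2.2.2.1 t.2.2.2.2.2 t.2.1 t.2.2.1 t.1 := by
    simp only [Fintype.sum_prod_type, Finset.smul_sum, smul_smul]
  rw [h1, h2]
  refine Fintype.sum_equiv
    { toFun := fun t => (t.2.2.2.2.2, t.2.2.1, t.2.2.2.2.1, t.2.2.2.1, t.1, t.2.1)
      invFun := fun t => (t.2.2.2.2.1, t.2.2.2.2.2, t.2.1, t.2.2.2.1, t.2.2.1, t.1)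
      left_inv := fun _ => rfl
      right_inv := fun _ => rfl } _ _ fun t => ?_
  simp only [Equiv.coe_fn_mk]
  congr 1
  ring

theorem sum_six_right {M : Type*} [AddCommGroup M] [Module ℂ M]
    (r : Fin n → Fin n → Fin n → Fin n → Fin n → Fin n → ℂ) (X : Fin n → Fin n → Fin n → M) :
    ∑ e, ∑ c, ∑ d, ∑ β, ∑ a, ∑ b, r a b c d β e • X a b e
      = ∑ e, ∑ a, ∑ b, (∑ c, ∑ d, ∑ β, r a b c d β e) • X a b e := by
  have h1 : ∑ e, ∑ c, ∑ d, ∑ β, ∑ a, ∑ b, r a b c d β e • X a b e =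
      ∑ t : Fin n × Fin n × Fin n × Fin n × Fin n × Fin n,
        r t.2.2.2.2.1 t.2.2.2.2.2 t.2.1 t.2.2.1 t.2.2.2.1 t.1 • X t.2.2.2.2.1 t.2.2.2.2.2 t.1 := by
    simp only [Fintype.sum_prod_type]
  have h2 : ∑ e, ∑ a, ∑ b, (∑ c, ∑ d, ∑ β, r a b c d β e) • X a b e =
      ∑ t : Fin n × Fin n × Fin n × Fin n × Fin n × Fin n,
        r t.2.1 t.2.2.1 t.2.2.2.1 t.2.2.2.2.1 t.2.2.2.2.2 t.1 • X t.2.1 t.2.2.1 t.1 := by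
    simp only [Fintype.sum_prod_type, Finset.sum_smul]
  rw [h1, h2]
  exact Fintype.sum_equiv
    { toFun := fun t => (t.1, t.2.2.2.2.1, t.2.2.2.2.2, t.2.1, t.2.2.1, t.2.2.2.1)
      invFun := fun t => (t.1, t.2.2.2.1, t.2.2.2.2.1, t.2.2.2.2.2, t.2.1, t.2.2.1)
      left_inv := fun _ => rfl
      right_inv := fun _ => rfl } _ _ fun t => rfl

theorem sum_six_right' {M : Type*} [AddCommGroup M] [Module ℂ M]
    (r : Fin n → Fin n → Fin n → Fin n → Fin n → Fin n → ℂ) (X : Fin n → Fin n → Fin n → M) :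
    ∑ a, ∑ b, ∑ d, ∑ β, ∑ c, ∑ e, r a b d β c e • X c d e
      = ∑ e, ∑ c, ∑ d, (∑ b, ∑ β, ∑ a, r a b d β c e) • X c d e := by
  have h1 : ∑ a, ∑ b, ∑ d, ∑ β, ∑ c, ∑ e, r a b d β c e • X c d e =
      ∑ t : Fin n × Fin n × Fin n × Fin n × Fin n × Fin n,
        r t.1 t.2.1 t.2.2.1 t.2.2.2.1 t.2.2.2.2.1 t.2.2.2.2.2 •
          X t.2.2.2.2.1 t.2.2.1 t.2.2.2.2.2 := by
    simp only [Fintype.sum_prod_type]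
  have h2 : ∑ e, ∑ c, ∑ d, (∑ b, ∑ β, ∑ a, r a b d β c e) • X c d e =
      ∑ t : Fin n × Fin n × Fin n × Fin n × Fin n × Fin n,
        r t.2.2.2.2.2 t.2.2.2.1 t.2.2.1 t.2.2.2.2.1 t.2.1 t.1 • X t.2.1 t.2.2.1 t.1 := by
    simp only [Fintype.sum_prod_type, Finset.sum_smul]
  rw [h1, h2]
  exact Fintype.sum_equiv
    { toFun := fun t => (t.2.2.2.2.2, t.2.2.2.2.1, t.2.2.1, t.2.1, t.2.2.2.1, t.1)
      invFun := fun t => (t.2.2.2.2.2, t.2.2.2.1, t.2.2.1, t.2.2.2.2.1, t.2.1, t.1)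
      left_inv := fun _ => rfl
      right_inv := fun _ => rfl } _ _ fun t => rfl

/-- The chain of `R`-matrices built on a monodromy matrix is a monodromy matrix. -/
theorem isMonodromy_chain {q : ℂ} (hq : q ≠ 0) {S : Set ℂ}
    {D : ℂ → Matrix (Fin n) (Fin n) (Module.End ℂ H)} (hD : IsMonodromy q S D) (x : List ℂ) :
    IsMonodromy q {u ∈ S | u ∉ x} (chain q D x) := by
  induction x with
  | nil =>
    rw [isMonodromy_iff] at hD ⊢
    intro u hu v hv huv i k j l ψ
    ext κ
    simpa only [Finset.sum_apply, Pi.smul_apply, chain_nil] using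
      hD u hu.1 v hv.1 huv i k j l (ψ κ)
  | cons a x ih =>
    rw [isMonodromy_iff] at ih ⊢
    intro u hu v hv huv i k j l ψ
    have hu' := List.ne_and_not_mem_of_not_mem_cons hu.2
    have hv' := List.ne_and_not_mem_of_not_mem_cons hv.2
    refine ext_slice fun s => ?_
    simp only [map_sum, map_smul, chain_cons]
    rw [sum_six_left (fun a' b' => rMatrix n q u v (i, k) (a', b'))
      (fun c β => rMatrix n q u a (c, s) (j, β)) (fun d β e => rMatrix n q v a (d, β) (l, e))
      fun a' b' c d e => chain q D x u a' c (chain q D x v b' d (slice e ψ))]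
    simp only [ih u ⟨hu.1, hu'.2⟩ v ⟨hv.1, hv'.2⟩ huv]
    simp only [Finset.smul_sum (s := Finset.univ (α := Fin n)), smul_smul]
    rw [sum_six_right (fun a' b' c d β e => rMatrix n q u a (c, s) (j, β) *
        rMatrix n q v a (d, β) (l, e) * rMatrix n q u v (a', b') (c, d))
      fun a' b' e => chain q D x v k b' (chain q D x u i a' (slice e ψ))]
    rw [sum_six_right' (fun a' b' d β c e => rMatrix n q u v (a', b') (j, l) *
        (rMatrix n q v a (d, s) (b', β) * rMatrix n q u a (c, β) (a', e)))
      fun c d e => chain q D x v k d (chain q D x u i c (slice e ψ))]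
    refine Finset.sum_congr rfl fun e _ => Finset.sum_congr rfl fun c _ =>
      Finset.sum_congr rfl fun d _ => ?_
    congr 1
    -- After the inductive hypothesis has exchanged the two shorter chains, only the `R`-matrices of
    -- the new site remain. Their Yang–Baxter equation needs `u` and `v` different from `a`, hence
    -- the removal of `x` from `S`.
    have := yangBaxter hq huv hu'.1 hv'.1 c d s j l e
    refine (Eq.trans ?_ this).trans ?_
    · refine Finset.sum_congr rfl fun _ _ => Finset.sum_congr rfl fun _ _ =>
        Finset.sum_congr rfl fun _ _ => by ring
    · refine Finset.sum_congr rfl fun _ _ => Finset.sum_congr rfl fun _ _ =>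
        Finset.sum_congr rfl fun _ _ => by ring

end chain

/-! ### Products over sets of parameters -/

section products

theorem prodOver_nil (φ : ℂ → ℂ) : prodOver φ [] = 1 := rfl

theorem prodOver_cons (φ : ℂ → ℂ) (a : ℂ) (x : List ℂ) :
    prodOver φ (a :: x) = φ a * prodOver φ x := by simp [prodOver]

theorem prodOver_perm (φ : ℂ → ℂ) {x y : List ℂ} (h : x.Perm y) : prodOver φ x = prodOver φ y :=
  (h.map φ).prod_eq

theorem fProd_singleton_left (q u : ℂ) (x : List ℂ) : fProd q [u] x = prodOver (fFun q u) x := by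
  simp [fProd, prodOver]

theorem fProd_nil_left (q : ℂ) (x : List ℂ) : fProd q [] x = 1 := rfl

theorem fProd_nil_right (q : ℂ) (x : List ℂ) : fProd q x [] = 1 := by simp [fProd, prodOver]

theorem fProd_cons_left (q a : ℂ) (x y : List ℂ) :
    fProd q (a :: x) y = fProd q [a] y * fProd q x y := by simp [fProd, prodOver]

theorem fProd_cons_right (q a : ℂ) (x y : List ℂ) :
    fProd q x (a :: y) = fProd q x [a] * fProd q x y := by
  simp [fProd, prodOver, List.prod_map_mul]

theorem fProd_perm (q : ℂ) {x x' y y' : List ℂ} (hx : x.Perm x') (hy : y.Perm y') :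
    fProd q x y = fProd q x' y' := by
  unfold fProd
  rw [prodOver_perm _ hx]
  congr 1
  ext u
  exact prodOver_perm _ hy

end products

/-! ### First-row products and Bethe vectors without normalisation -/

section betheRow
variable {n : ℕ} {H : Type*} [AddCommGroup H] [Module ℂ H]

/-- The product `T_{1,k_1}(x_1) ⋯ T_{1,k_r}(x_r)` contracted with the components of a vector. -/
def bRow (T : ℂ → Matrix (Fin (n + 1)) (Fin (n + 1)) (Module.End ℂ H)) :
    (x : List ℂ) → ((Fin x.length → Fin n) → H) →ₗ[ℂ] H
  | [] => LinearMap.proj Fin.elim0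
  | a :: x => ∑ k : Fin n, T a 0 k.succ ∘ₗ bRow T x ∘ₗ slice k

theorem bRow_cons (T : ℂ → Matrix (Fin (n + 1)) (Fin (n + 1)) (Module.End ℂ H)) (a : ℂ)
    (x : List ℂ) (ψ : (Fin (x.length + 1) → Fin n) → H) :
    bRow T (a :: x) ψ = ∑ k : Fin n, T a 0 k.succ (bRow T x (slice k ψ)) := by
  simp [bRow, LinearMap.sum_apply]

theorem bRow_eq_sum (T : ℂ → Matrix (Fin (n + 1)) (Fin (n + 1)) (Module.End ℂ H)) (x : List ℂ)
    (ψ : (Fin x.length → Fin n) → H) :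
    ∑ k : Fin x.length → Fin n,
        (List.ofFn fun s : Fin x.length => T (x.get s) 0 (k s).succ).prod (ψ k) = bRow T x ψ := by
  induction x with
  | nil =>
    have h : (default : Fin 0 → Fin n) = Fin.elim0 := Subsingleton.elim _ _
    exact (Fintype.sum_unique (ι := Fin 0 → Fin n) _).trans (congrArg ψ h)
  | cons a x ih =>
    rw [bRow_cons]
    refine (Fintype.sum_equiv (Fin.consEquiv fun _ : Fin (x.length + 1) => Fin n)
      (fun p : Fin n × (Fin x.length → Fin n) => T a 0 p.1.succ
        ((List.ofFn fun s : Fin x.length => T (x.get s) 0 (p.2 s).succ).prod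
          (ψ (Fin.cons p.1 p.2)))) _ fun p => ?_).symm.trans ?_
    · simp [Fin.consEquiv, List.ofFn_succ]
    · rw [Fintype.sum_prod_type]
      refine Finset.sum_congr rfl fun k _ => ?_
      rw [← ih, map_sum]
      rfl

theorem bRow_intertwine {H' : Type*} [AddCommGroup H'] [Module ℂ H']
    {T : ℂ → Matrix (Fin (n + 1)) (Fin (n + 1)) (Module.End ℂ H)}
    {T' : ℂ → Matrix (Fin (n + 1)) (Fin (n + 1)) (Module.End ℂ H')} (L : H →ₗ[ℂ] H') (x : List ℂ)
    (h : ∀ u ∈ x, ∀ i j w, L (T u i j w) = T' u i j (L w)) (ψ : (Fin x.length → Fin n) → H) :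
    L (bRow T x ψ) = bRow T' x (L.compLeft _ ψ) := by
  induction x with
  | nil => rfl
  | cons a x ih =>
    rw [bRow_cons, bRow_cons, map_sum]
    refine Finset.sum_congr rfl fun k _ => ?_
    rw [h a (by simp), ih fun u hu => h u (by simp [hu])]
    rfl

theorem compLeft_nestedVac {H' : Type*} [AddCommGroup H'] [Module ℂ H'] (L : H →ₗ[ℂ] H') (r : ℕ)
    (vac : H) : L.compLeft _ (nestedVac n r vac) = nestedVac n r (L vac) := by
  ext κ
  simp [nestedVac, Pi.single_apply, apply_ite L]

theorem slice_nestedVac (r : ℕ) (vac : H) (k : Fin (n + 1)) :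
    slice k (nestedVac n (r + 1) vac) = if k = 0 then nestedVac n r vac else 0 := by
  ext κ
  have : (Fin.cons k κ : Fin (r + 1) → Fin (n + 1)) = (fun _ => 0) ↔ k = 0 ∧ κ = fun _ => 0 := by
    constructor
    · intro h
      exact ⟨congrFun h 0, funext fun i => congrFun h i.succ⟩
    · rintro ⟨rfl, rfl⟩
      ext i
      refine Fin.cases ?_ (fun i => ?_) i <;> simp
  rw [slice_apply, nestedVac, Pi.single_apply]
  simp only [this, ite_and]
  split_ifs <;> simp_all [nestedVac]

/-- The Bethe vector without its normalisation factor. -/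
noncomputable def bHat (q : ℂ) : (N : ℕ) → {H : Type*} → [AddCommGroup H] → [Module ℂ H] →
    (ℂ → Matrix (Fin (N + 1)) (Fin (N + 1)) (Module.End ℂ H)) → H → (Fin N → List ℂ) → H
  | 0, _, _, _, _, vac, _ => vac
  | N + 1, _, _, _, T, vac, t =>
    bRow T (t 0) (bHat q N (chain q (block T) (t 0)) (nestedVac N (t 0).length vac)
      fun i => t i.succ)

theorem bHat_cons (q : ℂ) (N : ℕ)
    (T : ℂ → Matrix (Fin (N + 2)) (Fin (N + 2)) (Module.End ℂ H)) (vac : H) (x : List ℂ)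
    (t : Fin N → List ℂ) :
    bHat q (N + 1) T vac (Fin.cons x t) =
      bRow T x (bHat q N (chain q (block T) x) (nestedVac N x.length vac) t) := rfl

/-- The construction is natural in the space, the monodromy matrix and the vacuum, because an
intertwiner passes through every chain and every row product. Intertwining is needed only at the
Bethe parameters themselves. -/
theorem bHat_intertwine {H' : Type*} [AddCommGroup H'] [Module ℂ H'] (q : ℂ) (N : ℕ)
    {T : ℂ → Matrix (Fin (N + 1)) (Fin (N + 1)) (Module.End ℂ H)}
    {T' : ℂ → Matrix (Fin (N + 1)) (Fin (N + 1)) (Module.End ℂ H')} (L : H →ₗ[ℂ] H')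
    (t : Fin N → List ℂ)
    (h : ∀ i, ∀ u ∈ t i, ∀ a b w, L (T u a b w) = T' u a b (L w)) (vac : H) :
    L (bHat q N T vac t) = bHat q N T' (L vac) t := by
  induction N generalizing H H' with
  | zero => rfl
  | succ N ih =>
    rw [bHat, bHat, bRow_intertwine L _ (h 0)]
    congr 1
    rw [← compLeft_nestedVac]
    refine ih _ _ (fun i u hu a b w => ?_) _
    exact chain_intertwine q (D := block T) (D' := block T') L
      (fun i' j' w' => h i.succ u hu _ _ _) _ _ _ _

theorem bHat_smul (q : ℂ) (N : ℕ)
    (T : ℂ → Matrix (Fin (N + 1)) (Fin (N + 1)) (Module.End ℂ H)) (c : ℂ) (vac : H)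
    (t : Fin N → List ℂ) : bHat q N T (c • vac) t = c • bHat q N T vac t :=
  (bHat_intertwine q N (c • LinearMap.id) t (fun _ _ _ _ _ _ => by simp) vac).symm

theorem isPseudovacuum_chain {q : ℂ} {S : Set ℂ}
    {T : ℂ → Matrix (Fin (n + 2)) (Fin (n + 2)) (Module.End ℂ H)} {lam : Fin (n + 2) → ℂ → ℂ}
    {vac : H} (h : IsPseudovacuum S T lam vac) (x : List ℂ) :
    IsPseudovacuum S (chain q (block T) x) (nestedLam q lam x) (nestedVac n x.length vac) := by
  intro u hu
  induction x with
  | nil =>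
    constructor
    · intro i
      ext κ
      have hκ : κ = fun _ => 0 := Subsingleton.elim (α := Fin 0 → Fin (n + 1)) _ _
      rw [chain_nil, hκ]
      have := (h u hu).1 i.succ
      simp only [nestedVac, Pi.single_eq_same, Pi.smul_apply]
      refine this.trans ?_
      refine Fin.cases ?_ (fun i => ?_) i <;> simp [nestedLam, fProd, prodOver]
    · intro i j hij
      ext κ
      have hκ : κ = fun _ => 0 := Subsingleton.elim (α := Fin 0 → Fin (n + 1)) _ _
      rw [chain_nil, hκ]
      simp only [nestedVac, Pi.single_eq_same, Pi.zero_apply]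
      exact (h u hu).2 i.succ j.succ (Fin.succ_lt_succ_iff.2 hij)
  | cons a x ih =>
    -- With the new site in its first state, each row of the `R`-matrix contributes at most a
    -- diagonal and a swap term.
    have key : ∀ i j k, slice k (chain q (block T) (a :: x) u i j (nestedVac n (x.length + 1) vac))
        = (if k = 0 then rDiag q u a j 0 • chain q (block T) x u i j (nestedVac n x.length vac)
            else 0)
          + if k = j then rSwap q u a 0 k • chain q (block T) x u i 0 (nestedVac n x.length vac)
            else 0 := by
      intro i j k
      rw [chain_cons]
      simp only [slice_nestedVac, rMatrix_apply, add_smul, Finset.sum_add_distrib]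
      congr 1
      · rw [Finset.sum_eq_single j, Finset.sum_eq_single 0]
        · by_cases hk : k = 0 <;> simp [hk]
        · intro b _ hb; simp [hb]
        · simp
        · intro l _ hl; simp [hl]
        · simp
      · rw [Finset.sum_eq_single 0, Finset.sum_eq_single 0]
        · by_cases hk : k = j <;> simp [hk]
        · intro b _ hb; simp [hb]
        · simp
        · intro l _ hl
          refine Finset.sum_eq_zero fun b _ => ?_
          by_cases hb : b = 0
          · subst hb; simp [hl]
          · simp [hb]
        · simp
    constructor
    · intro i
      refine ext_slice fun k => ?_
      refine (key i i k).trans ?_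
      rw [map_smul, show nestedVac n (a :: x).length vac = nestedVac n (x.length + 1) vac from rfl,
        slice_nestedVac]
      rcases eq_or_ne i 0 with rfl | hi
      · rw [ih.1 0]
        by_cases hk : k = 0
        · subst hk
          simp only [if_true, rDiag, rSwap, lt_irrefl, if_false, zero_mul, zero_smul, add_zero, nestedLam,
            Fin.cons_zero, smul_smul]
          rw [fProd_cons_right q a, fProd_singleton_left q u [a], prodOver_cons, prodOver_nil]
          congr 1
          ring
        · simp [hk]
      -- For `i ≠ 0` the swap term is killed by triangularity of the shorter chain and the diagonal
      -- entry is `1`, so only the first eigenvalue acquires factors `f`.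
      · rw [ih.2 i 0 (Fin.pos_of_ne_zero hi), ih.1 i]
        obtain ⟨i, rfl⟩ := Fin.exists_succ_eq.2 hi
        by_cases hk : k = 0 <;> simp [hk, rDiag, nestedLam]
    · intro i j hij
      refine ext_slice fun k => ?_
      refine (key i j k).trans ?_
      rw [ih.2 i j hij, ih.2 i 0 (lt_of_le_of_lt (Fin.zero_le j) hij)]
      simp

end betheRow

/-! ### An additional site on the left, and extraction of a site -/

section leftR
variable {n : ℕ} {H : Type*} [AddCommGroup H] [Module ℂ H]

/-- The monodromy matrix `R_{0,s}(u, ξ) T(u)` with an additional site `s`, on `ℂ^n ⊗ H`. -/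
noncomputable def leftR (q : ℂ) (T : ℂ → Matrix (Fin n) (Fin n) (Module.End ℂ H)) (ξ u : ℂ) :
    Matrix (Fin n) (Fin n) (Module.End ℂ (Fin n → H)) :=
  Matrix.of fun i j => LinearMap.pi fun k =>
    ∑ a, ∑ b, rMatrix n q u ξ (i, k) (a, b) • (T u a j ∘ₗ LinearMap.proj b)

theorem leftR_apply_sum (q : ℂ) (T : ℂ → Matrix (Fin n) (Fin n) (Module.End ℂ H)) (ξ u : ℂ)
    (i j k : Fin n) (φ : Fin n → H) :
    leftR q T ξ u i j φ k = ∑ a, ∑ b, rMatrix n q u ξ (i, k) (a, b) • T u a j (φ b) := by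
  simp [leftR, LinearMap.sum_apply]

theorem leftR_apply (q : ℂ) (T : ℂ → Matrix (Fin n) (Fin n) (Module.End ℂ H)) (ξ u : ℂ)
    (i j k : Fin n) (φ : Fin n → H) :
    leftR q T ξ u i j φ k
      = rDiag q u ξ i k • T u i j (φ k) + rSwap q u ξ i k • T u k j (φ i) := by
  rw [leftR_apply_sum, sum_rMatrix_row q u ξ i k fun a b => T u a j (φ b)]

/-- The operator that moves the site at position `p` of a chain to the front, and acts on it with
the value at `x_p` of the monodromy matrix of the other sites. -/
noncomputable def extract (q : ℂ) (D : ℂ → Matrix (Fin n) (Fin n) (Module.End ℂ H)) :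
    (x : List ℂ) → (p : Fin x.length) →
      ((Fin x.length → Fin n) → H) →ₗ[ℂ] (Fin n → (Fin (x.eraseIdx p).length → Fin n) → H)
  | a :: x, ⟨0, _⟩ => LinearMap.pi fun j => ∑ k, chain q D x a j k ∘ₗ slice k
  | b :: x, ⟨p + 1, hp⟩ => LinearMap.pi fun j =>
      fFun q (x.get ⟨p, Nat.lt_of_succ_lt_succ hp⟩) b • unslice fun k =>
        LinearMap.proj j ∘ₗ extract q D x ⟨p, Nat.lt_of_succ_lt_succ hp⟩ ∘ₗ slice k

theorem extract_zero (q : ℂ) (D : ℂ → Matrix (Fin n) (Fin n) (Module.End ℂ H)) (a : ℂ)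
    (x : List ℂ) (ψ : (Fin (x.length + 1) → Fin n) → H) (j : Fin n) :
    extract q D (a :: x) (0 : Fin (x.length + 1)) ψ j = ∑ k, chain q D x a j k (slice k ψ) := by
  change (∑ k, chain q D x a j k ∘ₗ slice k) ψ = _
  simp [LinearMap.sum_apply]

theorem slice_extract_succ (q : ℂ) (D : ℂ → Matrix (Fin n) (Fin n) (Module.End ℂ H)) (b : ℂ)
    (x : List ℂ) (p : Fin x.length) (ψ : (Fin (x.length + 1) → Fin n) → H) (j k : Fin n) :
    slice k (extract q D (b :: x) p.succ ψ j :
        (Fin ((x.eraseIdx p).length + 1) → Fin n) → H)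
      = fFun q (x.get p) b • extract q D x p (slice k ψ) j := rfl

/-- For the first site this is the RTT relation of the remaining chain at `u` and `a`: the
`R`-matrix moves from the right end of the product to the left end. For a later site, the sites in
front of it are untouched by the extraction and their `R`-matrices are merely carried along. -/
theorem extract_intertwine {q : ℂ} (hq : q ≠ 0) {S : Set ℂ}
    {D : ℂ → Matrix (Fin n) (Fin n) (Module.End ℂ H)} (hD : IsMonodromy q S D) (x : List ℂ)
    (hx : ∀ a ∈ x, a ∈ S) (hnd : x.Nodup) (p : Fin x.length) {u : ℂ} (hu : u ∈ S) (hux : u ∉ x)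
    (i j : Fin n) (ψ : (Fin x.length → Fin n) → H) :
    extract q D x p (chain q D x u i j ψ)
      = leftR q (chain q D (x.eraseIdx p)) (x.get p) u i j (extract q D x p ψ) := by
  induction x generalizing i j with
  | nil => exact absurd p.2 (Nat.not_lt_zero _)
  | cons a x ih =>
    have hux' := List.ne_and_not_mem_of_not_mem_cons hux
    have hnd' := List.nodup_cons.1 hnd
    ext1 j'
    refine Fin.cases ?_ (fun p => ?_) p
    · refine (extract_zero q D a x (chain q D (a :: x) u i j ψ) j').trans ?_
      refine Eq.trans ?_ (leftR_apply_sum q (chain q D x) a u i j j'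
        (extract q D (a :: x) (0 : Fin (x.length + 1)) ψ)).symm
      simp only [chain_cons, extract_zero, map_sum, map_smul, Finset.smul_sum]
      -- The exchange relation needs `a` outside the remaining sites, hence the assumption of no
      -- repetitions.
      have key := isMonodromy_iff.1 (isMonodromy_chain hq hD x) u ⟨hu, hux'.2⟩ a
        ⟨hx a (by simp), hnd'.1⟩ hux'.1
      have h1 : ∀ b : Fin n, ∑ k, ∑ l, rMatrix n q u a (l, k) (j, b) •
          chain q D x a j' k (chain q D x u i l (slice b ψ)) =
          ∑ l, ∑ b', rMatrix n q u a (i, j') (l, b') •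
            chain q D x u l j (chain q D x a b' b (slice b ψ)) := by
        intro b
        rw [key, Finset.sum_comm]
      calc _ = ∑ b, ∑ k, ∑ l, rMatrix n q u a (l, k) (j, b) •
          chain q D x a j' k (chain q D x u i l (slice b ψ)) := by
            exact (Finset.sum_congr rfl fun k _ => Finset.sum_comm).trans Finset.sum_comm
        _ = ∑ b, ∑ l, ∑ b', rMatrix n q u a (i, j') (l, b') •
            chain q D x u l j (chain q D x a b' b (slice b ψ)) :=
            Finset.sum_congr rfl fun b _ => h1 b
        _ = _ := Finset.sum_comm.trans (Finset.sum_congr rfl fun l _ => Finset.sum_comm)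
    · refine ext_slice (r := (x.eraseIdx p).length) fun k => ?_
      refine (slice_extract_succ q D a x p (chain q D (a :: x) u i j ψ) j' k).trans ?_
      refine Eq.trans ?_ (congrArg (slice k) (leftR_apply_sum q (chain q D (a :: x.eraseIdx p))
        (x.get p) u i j j' (extract q D (a :: x) p.succ ψ))).symm
      have h1 : ∀ b' c, slice c (extract q D (a :: x) p.succ ψ b' :
        (Fin ((x.eraseIdx p).length + 1) → Fin n) → H)
          = fFun q (x.get p) a • extract q D x p (slice c ψ) b' := fun b' c => rfl
      simp only [chain_cons, map_sum, map_smul, Finset.sum_apply, Pi.smul_apply]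
      simp only [ih (fun b hb => hx b (by simp [hb])) hnd'.2 p hux'.2, leftR_apply_sum,
        Finset.smul_sum]
      calc _ = ∑ l', ∑ b', ∑ l, ∑ c, fFun q (x.get p) a • rMatrix n q u a (l, k) (j, c) •
            rMatrix n q u (x.get p) (i, j') (l', b') •
              chain q D (x.eraseIdx p) u l' l (extract q D x p (slice c ψ) b') :=
            (Finset.sum_congr rfl fun l _ => Finset.sum_comm.trans
              (Finset.sum_congr rfl fun _ _ => Finset.sum_comm)).trans
              (Finset.sum_comm.trans (Finset.sum_congr rfl fun _ _ => Finset.sum_comm))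
        _ = _ := by
            refine Finset.sum_congr rfl fun l' _ => Finset.sum_congr rfl fun b' _ => ?_
            refine Eq.trans ?_ (congrArg (rMatrix n q u (x.get p) (i, j') (l', b') • ·)
              (chain_cons q D a (x.eraseIdx p) u l' j k
                (extract q D (a :: x) p.succ ψ b'))).symm
            simp only [h1, map_smul, Finset.smul_sum]
            refine Finset.sum_congr rfl fun l _ => Finset.sum_congr rfl fun c _ => ?_
            simp only [smul_smul]
            congr 1
            ring

end leftR

/-! ### Moving an entry through the first-row operators -/

section action
variable {n : ℕ} {H : Type*} [AddCommGroup H] [Module ℂ H]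

/-- The eigenvalue of the remaining chain at `x_p` supplies `λ_2` and `f` over the later sites. The
factors `f` over the earlier sites are those built into `extract`, so the result is symmetric in the
other sites. -/
theorem extract_nestedVac {q : ℂ} {S : Set ℂ}
    {T : ℂ → Matrix (Fin (n + 2)) (Fin (n + 2)) (Module.End ℂ H)} {lam : Fin (n + 2) → ℂ → ℂ}
    {vac : H} (h : IsPseudovacuum S T lam vac) (x : List ℂ) (hx : ∀ a ∈ x, a ∈ S)
    (p : Fin x.length) :
    extract q (block T) x p (nestedVac n x.length vac)
      = (lam 1 (x.get p) * fProd q [x.get p] (x.eraseIdx p)) •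
          Pi.single 0 (nestedVac n (x.eraseIdx p).length vac) := by
  induction x with
  | nil => exact absurd p.2 (Nat.not_lt_zero _)
  | cons a x ih =>
    ext1 j
    refine Fin.cases ?_ (fun p => ?_) p
    · refine (extract_zero q (block T) a x (nestedVac n (x.length + 1) vac) j).trans ?_
      have hv := isPseudovacuum_chain (q := q) h x a (hx a (by simp))
      simp only [slice_nestedVac]
      rw [Finset.sum_eq_single 0 (fun b _ hb => by simp [hb]) (by simp), if_pos rfl]
      rcases eq_or_ne j 0 with rfl | hj
      · rw [hv.1 0, Pi.smul_apply, Pi.single_eq_same]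
        rfl
      · rw [hv.2 j 0 (Fin.pos_of_ne_zero hj), Pi.smul_apply, Pi.single_eq_of_ne hj, smul_zero]
        rfl
    · refine ext_slice (r := (x.eraseIdx p).length) fun k => ?_
      refine (slice_extract_succ q (block T) a x p (nestedVac n (x.length + 1) vac) j k).trans ?_
      have h1 : fProd q [x.get p] (a :: x.eraseIdx p)
          = fFun q (x.get p) a * fProd q [x.get p] (x.eraseIdx p) := by
        rw [fProd_singleton_left, prodOver_cons, fProd_singleton_left]
      have h2 : slice k ((Pi.single 0 (nestedVac n ((x.eraseIdx p).length + 1) vac) :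
          Fin (n + 1) → (Fin ((x.eraseIdx p).length + 1) → Fin (n + 1)) → H) j)
          = if k = 0 then (Pi.single 0 (nestedVac n (x.eraseIdx p).length vac) :
            Fin (n + 1) → (Fin (x.eraseIdx p).length → Fin (n + 1)) → H) j else 0 := by
        rcases eq_or_ne j 0 with rfl | hj
        · simp only [Pi.single_eq_same, slice_nestedVac]
        · simp [Pi.single_eq_of_ne hj]
      have h3 := ih (fun b hb => hx b (by simp [hb])) p
      rw [slice_nestedVac]
      calc _ = (lam 1 (x.get p) * fProd q [x.get p] (a :: x.eraseIdx p)) •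
            slice k ((Pi.single 0 (nestedVac n ((x.eraseIdx p).length + 1) vac) :
          Fin (n + 1) → (Fin ((x.eraseIdx p).length + 1) → Fin (n + 1)) → H) j) := by
            rw [h2, h1]
            split_ifs
            · rw [h3, Pi.smul_apply, smul_smul]
              congr 1
              ring
            · simp
        _ = _ := rfl

/-- Three-term identity that merges the two ways in which `z` can be exchanged with a later
parameter `x`: directly, or through `a`. -/
theorem fFun_mul_gRight (q : ℂ) {z a x : ℂ} (hza : z ≠ a) (hzx : z ≠ x) (hax : a ≠ x) :
    fFun q z a * gRight q z x - gRight q z a * gRight q a x = gRight q z x * fFun q x a := by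
  have h1 := sub_ne_zero.2 hza
  have h2 := sub_ne_zero.2 hzx
  have h3 := sub_ne_zero.2 hax
  have h4 := sub_ne_zero.2 hax.symm
  simp only [fFun, gRight, gFun]
  generalize q⁻¹ = r
  field_simp
  ring

/-- Analogue of `fFun_mul_gRight` for the additional site, used in `bRow_leftR_succ`. -/
theorem gFun_sub_mul (q : ℂ) (hq : q ≠ 0) {ξ a x : ℂ} (hxξ : x ≠ ξ) (haξ : a ≠ ξ) (hax : a ≠ x) :
    x * gFun q x ξ - a * gFun q a ξ * fFun q x ξ * gRight q a x
      = x * gFun q x ξ * fFun q a ξ * fFun q x a := by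
  have h1 := sub_ne_zero.2 hxξ
  have h2 := sub_ne_zero.2 haξ
  have h3 := sub_ne_zero.2 hax
  have h4 := sub_ne_zero.2 hax.symm
  simp only [fFun, gRight, gFun]
  field_simp
  ring

variable {q : ℂ} {S : Set ℂ} {T : ℂ → Matrix (Fin (n + 1)) (Fin (n + 1)) (Module.End ℂ H)}

/-- The exchange relations between the first row and the entries of the lower right block. -/
theorem exchange_row (hT : IsMonodromy q S T) {z a : ℂ} (hz : z ∈ S) (ha : a ∈ S) (hza : z ≠ a)
    (i : Fin (n + 1)) (l b : Fin n) (h : H) :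
    ∑ p, ∑ k, rMatrix n q z a (p, k) (l, b) • T a 0 k.succ (T z i p.succ h)
      = rDiag q z a i 0 • T z i l.succ (T a 0 b.succ h)
        + rSwap q z a i 0 • T z 0 l.succ (T a i b.succ h) := by
  rw [sum_rMatrix_col q z a l b fun p k => T a 0 k.succ (T z i p.succ h),
    hT.exchange hz ha hza i 0 l.succ b.succ h, rDiag_succ, rSwap_succ]

/-- A product of entries of the first row, applied to the nested monodromy matrix. -/
theorem bRow_chain (hT : IsMonodromy q S T) (x : List ℂ) (hx : ∀ a ∈ x, a ∈ S) (hnd : x.Nodup)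
    {z : ℂ} (hz : z ∈ S) (hzx : z ∉ x) (j l : Fin n) (ψ : (Fin x.length → Fin n) → H) :
    bRow T x (chain q (block T) x z j l ψ)
      = T z j.succ l.succ (bRow T x ψ) + T z 0 l.succ (∑ p : Fin x.length,
          gRight q z (x.get p) • bRow T (x.eraseIdx p) (extract q (block T) x p ψ j)) := by
  induction x generalizing z l with
  | nil =>
    simp only [bRow, LinearMap.proj_apply, chain_nil]
    have : (∑ p : Fin ([] : List ℂ).length, gRight q z (([] : List ℂ).get p) •
      bRow T (([] : List ℂ).eraseIdx p) (extract q (block T) [] p ψ j)) = 0 :=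
      Finset.sum_eq_zero fun p _ => absurd p.2 (Nat.not_lt_zero _)
    rw [this, map_zero, add_zero]
    rfl
  | cons a x ih =>
    have hzx' := List.ne_and_not_mem_of_not_mem_cons hzx
    have hnd' := List.nodup_cons.1 hnd
    have hxS : ∀ b ∈ x, b ∈ S := fun b hb => hx b (by simp [hb])
    have haS : a ∈ S := hx a (by simp)
    -- The unwanted terms of the shorter product, as a function of the spectral parameter: the
    -- inductive hypothesis is used at `z` and also at `a`.
    set γ : ℂ → Fin n → H := fun y b => ∑ p : Fin x.length,
      gRight q y (x.get p) • bRow T (x.eraseIdx p) (extract q (block T) x p (slice b ψ) j) with hγ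
    have e1 : ∑ p : Fin (a :: x).length, gRight q z ((a :: x).get p) •
        bRow T ((a :: x).eraseIdx p) (extract q (block T) (a :: x) p ψ j)
        = ∑ b, (gRight q z a • T a j.succ b.succ (bRow T x (slice b ψ))
          + fFun q z a • T a 0 b.succ (γ z b)) := by
      have e2 : ∀ p : Fin x.length, gRight q z (x.get p) •
          bRow T (a :: x.eraseIdx p) (extract q (block T) (a :: x) p.succ ψ j)
          = ∑ b, T a 0 b.succ ((gRight q z (x.get p) * fFun q (x.get p) a) •
            bRow T (x.eraseIdx p) (extract q (block T) x p (slice b ψ) j)) := by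
        intro p
        refine (congrArg _ (bRow_cons T a (x.eraseIdx p)
          (extract q (block T) (a :: x) p.succ ψ j))).trans ?_
        rw [Finset.smul_sum]
        refine Finset.sum_congr rfl fun b _ => ?_
        have := slice_extract_succ q (block T) a x p ψ j b
        refine (congrArg (fun v => gRight q z (x.get p) • T a 0 b.succ
          (bRow T (x.eraseIdx p) v)) this).trans ?_
        simp only [map_smul, smul_smul]
      have e3 : bRow T x (extract q (block T) (a :: x) (0 : Fin (x.length + 1)) ψ j)
          = ∑ b, (T a j.succ b.succ (bRow T x (slice b ψ)) + T a 0 b.succ (γ a b)) := by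
        refine (congrArg _ (extract_zero q (block T) a x ψ j)).trans ?_
        rw [map_sum]
        exact Finset.sum_congr rfl fun b _ => ih hxS hnd'.2 haS hnd'.1 b _
      refine (Fin.sum_univ_succ (n := x.length) _).trans ?_
      refine (congrArg₂ (· + ·) (congrArg (gRight q z a • ·) e3)
        (Finset.sum_congr rfl fun p _ => e2 p)).trans ?_
      rw [Finset.sum_comm (t := (Finset.univ : Finset (Fin n))), Finset.smul_sum,
        ← Finset.sum_add_distrib]
      refine Finset.sum_congr rfl fun b _ => ?_
      have e4 : ∑ p : Fin x.length, (gRight q z (x.get p) * fFun q (x.get p) a) •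
            bRow T (x.eraseIdx p) (extract q (block T) x p (slice b ψ) j)
          = fFun q z a • γ z b - gRight q z a • γ a b := by
        simp only [hγ, Finset.smul_sum, smul_smul]
        rw [← Finset.sum_sub_distrib]
        refine Finset.sum_congr rfl fun p _ => ?_
        rw [← sub_smul]
        congr 1
        have hp : x.get p ∈ x := List.get_mem x p
        exact (fFun_mul_gRight q hzx'.1 (ne_of_mem_of_not_mem hp hzx'.2).symm
          (ne_of_mem_of_not_mem hp hnd'.1).symm).symm
      rw [← map_sum, e4, map_sub, map_smul, map_smul, smul_add]
      abel
    rw [e1]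
    refine (bRow_cons T a x _).trans ?_
    refine Eq.trans ?_ (congrArg (fun v => T z j.succ l.succ v + _) (bRow_cons T a x ψ)).symm
    have e5 : ∀ k : Fin n, T a 0 k.succ (bRow T x (slice k (chain q (block T) (a :: x) z j l ψ)))
        = ∑ p, ∑ b, (rMatrix n q z a (p, k) (l, b) •
            T a 0 k.succ (T z j.succ p.succ (bRow T x (slice b ψ)))
          + rMatrix n q z a (p, k) (l, b) • T a 0 k.succ (T z 0 p.succ (γ z b))) := by
      intro k
      simp only [chain_cons, map_sum, map_smul, ih hxS hnd'.2 hz hzx'.2, smul_add, map_add, hγ]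
    refine (Finset.sum_congr rfl fun k _ => e5 k).trans ?_
    calc _ = ∑ b, ((∑ p, ∑ k, rMatrix n q z a (p, k) (l, b) •
            T a 0 k.succ (T z j.succ p.succ (bRow T x (slice b ψ))))
          + ∑ p, ∑ k, rMatrix n q z a (p, k) (l, b) • T a 0 k.succ (T z 0 p.succ (γ z b))) := by
            simp only [← Finset.sum_add_distrib]
            exact Finset.sum_comm.trans ((Finset.sum_congr rfl fun p _ => Finset.sum_comm).trans
              Finset.sum_comm)
      _ = _ := by
            rw [map_sum, map_sum, ← Finset.sum_add_distrib]
            refine Finset.sum_congr rfl fun b _ => ?_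
            -- The wanted term exchanges two different rows and yields two terms; the unwanted one
            -- exchanges two first-row entries and yields just the factor `f(z, a)`. This is the
            -- expansion found in `e1`.
            rw [exchange_row hT hz haS hzx'.1, exchange_row hT hz haS hzx'.1]
            have r1 : rDiag q z a j.succ (0 : Fin (n + 1)) = 1 := by simp [rDiag]
            have r2 : rSwap q z a j.succ (0 : Fin (n + 1)) = gRight q z a := by
              simp [rSwap, gRight]
            have r3 : rDiag q z a (0 : Fin (n + 1)) 0 = fFun q z a := by simp [rDiag]
            have r4 : rSwap q z a (0 : Fin (n + 1)) 0 = 0 := by simp [rSwap]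
            rw [r1, r2, r3, r4, one_smul, zero_smul, add_zero, map_add, map_smul, map_smul, add_assoc]

/-- The additional site in its first state. -/
noncomputable def siteZero (n : ℕ) (H : Type*) [AddCommGroup H] [Module ℂ H] :
    H →ₗ[ℂ] (Fin (n + 1) → H) := LinearMap.single ℂ (fun _ => H) 0

/-- When both the row index and the site are in the first state, the `R`-matrix acts by the scalar
`f`. -/
theorem bRow_leftR_zero (q ξ : ℂ) (T : ℂ → Matrix (Fin (n + 1)) (Fin (n + 1)) (Module.End ℂ H))
    (x : List ℂ) (ψ : (Fin x.length → Fin n) → H) :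
    bRow (leftR q T ξ) x ((siteZero n H).compLeft _ ψ) 0 = fProd q x [ξ] • bRow T x ψ := by
  induction x with
  | nil => simp [bRow, siteZero, fProd_nil_left, LinearMap.compLeft_apply]
  | cons a x ih =>
    rw [bRow_cons, fProd_cons_left]
    refine Eq.trans ?_ (congrArg _ (bRow_cons T a x ψ)).symm
    rw [Finset.sum_apply, Finset.smul_sum]
    refine Finset.sum_congr rfl fun k _ => ?_
    rw [leftR_apply]
    refine (congrArg (fun v => rDiag q a ξ (0 : Fin (n + 1)) 0 • T a 0 k.succ v
      + rSwap q a ξ (0 : Fin (n + 1)) 0 • T a 0 k.succ v) (ih (slice k ψ))).trans ?_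
    simp [rDiag, rSwap, smul_smul, fProd_singleton_left, prodOver_cons, prodOver_nil]

/-- The site leaves its first state through a single swap, at some parameter `a`, which turns a
first-row entry at `a` into an entry of row `j.succ`. `bRow_chain`, read backwards, expresses that
entry through the extraction of sites. -/
theorem bRow_leftR_succ (hq : q ≠ 0) (hT : IsMonodromy q S T) (x : List ℂ)
    (hx : ∀ a ∈ x, a ∈ S) (hnd : x.Nodup) {ξ : ℂ} (hξ : ξ ∉ x) (j : Fin n)
    (ψ : (Fin x.length → Fin n) → H) :
    bRow (leftR q T ξ) x ((siteZero n H).compLeft _ ψ) j.succ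
      = ∑ p : Fin x.length, (x.get p * gFun q (x.get p) ξ * fProd q (x.eraseIdx p) [ξ]) •
          bRow T (x.eraseIdx p) (extract q (block T) x p ψ j) := by
  induction x with
  | nil =>
    refine Eq.trans ?_ (Finset.sum_eq_zero fun p _ => absurd p.2 (Nat.not_lt_zero _)).symm
    simp [bRow, siteZero, LinearMap.compLeft_apply]
  | cons a x ih =>
    have hξx := List.ne_and_not_mem_of_not_mem_cons hξ
    have hnd' := List.nodup_cons.1 hnd
    have hxS : ∀ b ∈ x, b ∈ S := fun b hb => hx b (by simp [hb])
    have haS : a ∈ S := hx a (by simp)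
    have e3 : bRow T x (extract q (block T) (a :: x) (0 : Fin (x.length + 1)) ψ j)
        = ∑ b, (T a j.succ b.succ (bRow T x (slice b ψ)) + T a 0 b.succ (∑ p : Fin x.length,
          gRight q a (x.get p) • bRow T (x.eraseIdx p)
            (extract q (block T) x p (slice b ψ) j))) := by
      refine (congrArg _ (extract_zero q (block T) a x ψ j)).trans ?_
      rw [map_sum]
      exact Finset.sum_congr rfl fun b _ => bRow_chain hT x hxS hnd'.2 haS hnd'.1 _ _ _
    have e2 : ∀ p : Fin x.length,
        (x.get p * gFun q (x.get p) ξ * fProd q (a :: x.eraseIdx p) [ξ]) •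
        bRow T (a :: x.eraseIdx p) (extract q (block T) (a :: x) p.succ ψ j)
        = ∑ b, T a 0 b.succ ((x.get p * gFun q (x.get p) ξ * fProd q (a :: x.eraseIdx p) [ξ]
          * fFun q (x.get p) a) •
          bRow T (x.eraseIdx p) (extract q (block T) x p (slice b ψ) j)) := by
      intro p
      refine (congrArg _ (bRow_cons T a (x.eraseIdx p)
        (extract q (block T) (a :: x) p.succ ψ j))).trans ?_
      rw [Finset.smul_sum]
      refine Finset.sum_congr rfl fun b _ => ?_
      have := slice_extract_succ q (block T) a x p ψ j b
      refine (congrArg (fun v => (x.get p * gFun q (x.get p) ξ *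
        fProd q (a :: x.eraseIdx p) [ξ]) • T a 0 b.succ
        (bRow T (x.eraseIdx p) v)) this).trans ?_
      simp only [map_smul, smul_smul]
    refine Eq.trans ?_ (Fin.sum_univ_succ (n := x.length) _).symm
    refine Eq.trans ?_ (congrArg₂ (· + ·)
      (congrArg ((a * gFun q a ξ * fProd q x [ξ]) • ·) e3)
      (Finset.sum_congr rfl fun p _ => e2 p)).symm
    rw [Finset.sum_comm (t := (Finset.univ : Finset (Fin n))), Finset.smul_sum,
      ← Finset.sum_add_distrib, bRow_cons, Finset.sum_apply]
    refine Finset.sum_congr rfl fun b _ => ?_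
    rw [leftR_apply]
    refine (congrArg₂ (fun v w => rDiag q a ξ (0 : Fin (n + 1)) j.succ • T a 0 b.succ v
      + rSwap q a ξ (0 : Fin (n + 1)) j.succ • T a j.succ b.succ w)
      (ih hxS hnd'.2 hξx.2 (slice b ψ)) (bRow_leftR_zero q ξ T x (slice b ψ))).trans ?_
    have r1 : rDiag q a ξ (0 : Fin (n + 1)) j.succ = 1 := by
      simp [rDiag, (Fin.succ_ne_zero j).symm]
    have r2 : rSwap q a ξ (0 : Fin (n + 1)) j.succ = a * gFun q a ξ := by simp [rSwap]
    have e4 : ∑ p : Fin x.length, (x.get p * gFun q (x.get p) ξ *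
          fProd q (a :: x.eraseIdx p) [ξ] * fFun q (x.get p) a) •
          bRow T (x.eraseIdx p) (extract q (block T) x p (slice b ψ) j)
        = (∑ p : Fin x.length, (x.get p * gFun q (x.get p) ξ * fProd q (x.eraseIdx p) [ξ]) •
          bRow T (x.eraseIdx p) (extract q (block T) x p (slice b ψ) j))
          - (a * gFun q a ξ * fProd q x [ξ]) • ∑ p : Fin x.length, gRight q a (x.get p) •
            bRow T (x.eraseIdx p) (extract q (block T) x p (slice b ψ) j) := by
      simp only [Finset.smul_sum, smul_smul]
      rw [← Finset.sum_sub_distrib]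
      refine Finset.sum_congr rfl fun p _ => ?_
      rw [← sub_smul]
      congr 1
      have hp : x.get p ∈ x := List.get_mem x p
      have h1 := gFun_sub_mul q hq (ne_of_mem_of_not_mem hp hξx.2) hξx.1.symm
        (ne_of_mem_of_not_mem hp hnd'.1).symm
      have h2 : fProd q x [ξ] = fFun q (x.get p) ξ * fProd q (x.eraseIdx p) [ξ] := by
        rw [fProd_perm q (List.getElem_cons_eraseIdx_perm p.2).symm (List.Perm.refl _),
          fProd_cons_left]
        simp [fProd_singleton_left, prodOver]
      have h3 : fProd q (a :: x.eraseIdx p) [ξ] = fFun q a ξ * fProd q (x.eraseIdx p) [ξ] := by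
        rw [fProd_cons_left]
        simp [fProd_singleton_left, prodOver]
      rw [h2, h3]
      linear_combination (-fProd q (x.eraseIdx p) [ξ]) * h1
    rw [r1, r2, ← map_sum, e4, map_sub, map_smul, map_smul, smul_add, one_smul, smul_smul]
    abel

end action

/-! ### Regular parameters -/

section regular

/-- The parameters lie in `S` and are pairwise distinct. -/
def RegularParams {N : ℕ} (S : Set ℂ) (t : Fin N → List ℂ) : Prop :=
  (∀ i, ∀ a ∈ t i, a ∈ S) ∧ (∀ i, (t i).Nodup) ∧ ∀ i j a, a ∈ t i → a ∈ t j → i = j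

theorem RegularParams.sublist {N : ℕ} {S : Set ℂ} {t t' : Fin N → List ℂ} (h : RegularParams S t)
    (ht : ∀ i, (t' i).Sublist (t i)) : RegularParams S t' :=
  ⟨fun i a ha => h.1 i a ((ht i).subset ha), fun i => (h.2.1 i).sublist (ht i),
    fun i j a hi hj => h.2.2 i j a ((ht i).subset hi) ((ht j).subset hj)⟩

/-- Distinctness across the sets keeps the remaining parameters away from the sites of the nested
chain. -/
theorem RegularParams.tail {N : ℕ} {S : Set ℂ} {t : Fin (N + 1) → List ℂ} (h : RegularParams S t) :
    RegularParams {u ∈ S | u ∉ t 0} fun i => t i.succ :=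
  ⟨fun i a ha => ⟨h.1 i.succ a ha, fun h0 => Fin.succ_ne_zero i (h.2.2 _ _ a ha h0)⟩,
    fun i => h.2.1 i.succ, fun _ _ a hi hj => Fin.succ_injective _ (h.2.2 _ _ a hi hj)⟩

theorem RegularParams.mono {N : ℕ} {S S' : Set ℂ} {t : Fin N → List ℂ} (h : RegularParams S t)
    (hS : S ⊆ S') : RegularParams S' t := ⟨fun i a ha => hS (h.1 i a ha), h.2⟩

theorem IsPseudovacuum.mono {m : ℕ} {H : Type*} [AddCommGroup H] [Module ℂ H] {S S' : Set ℂ}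
    {T : ℂ → Matrix (Fin m) (Fin m) (Module.End ℂ H)} {lam : Fin m → ℂ → ℂ} {vac : H}
    (h : IsPseudovacuum S T lam vac) (hS : S' ⊆ S) : IsPseudovacuum S' T lam vac :=
  fun u hu => h u (hS hu)

end regular

/-! ### Iterated sums over one-element parts and their collapse -/

section sums
variable {M M' : Type*} [AddCommGroup M] [Module ℂ M] [AddCommGroup M'] [Module ℂ M']

/-- The sum over one-element parts of the first `j` sets of parameters that describes the
components of the Bethe vector of a monodromy matrix with one additional site. -/
noncomputable def evSum (q : ℂ) : (n : ℕ) → (w : Fin (n + 1) → ℂ → ℂ) → (ξ : ℂ) →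
    (t : Fin (n + 1) → List ℂ) → (j : Fin (n + 1)) → (F : (Fin (n + 1) → List ℂ) → M) → M
  | 0, _, ξ, t, _, F => fProd q (t 0) [ξ] • F t
  | n + 1, w, ξ, t, j, F => Fin.cases (fProd q (t 0) [ξ] • F t)
      (fun j => ∑ p : Fin (t 0).length,
        ((t 0).get p * gFun q ((t 0).get p) ξ * fProd q ((t 0).eraseIdx p) [ξ]
          * (w 0 ((t 0).get p) * fProd q [(t 0).get p] ((t 0).eraseIdx p))) •
        evSum q n (fun i => w i.succ) ((t 0).get p) (fun i => t i.succ) j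
          fun t' => F (Fin.cons ((t 0).eraseIdx p) t')) j

theorem evSum_zero (q : ℂ) (n : ℕ) (w : Fin (n + 1) → ℂ → ℂ) (ξ : ℂ) (t : Fin (n + 1) → List ℂ)
    (F : (Fin (n + 1) → List ℂ) → M) : evSum q n w ξ t 0 F = fProd q (t 0) [ξ] • F t := by
  cases n <;> rfl

theorem evSum_succ (q : ℂ) (n : ℕ) (w : Fin (n + 2) → ℂ → ℂ) (ξ : ℂ) (t : Fin (n + 2) → List ℂ)
    (j : Fin (n + 1)) (F : (Fin (n + 2) → List ℂ) → M) :
    evSum q (n + 1) w ξ t j.succ F = ∑ p : Fin (t 0).length,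
        ((t 0).get p * gFun q ((t 0).get p) ξ * fProd q ((t 0).eraseIdx p) [ξ]
          * (w 0 ((t 0).get p) * fProd q [(t 0).get p] ((t 0).eraseIdx p))) •
        evSum q n (fun i => w i.succ) ((t 0).get p) (fun i => t i.succ) j
          fun t' => F (Fin.cons ((t 0).eraseIdx p) t') := rfl

theorem evSum_cons_succ (q : ℂ) (n : ℕ) (w : Fin (n + 2) → ℂ → ℂ) (ξ : ℂ) (x : List ℂ)
    (t : Fin (n + 1) → List ℂ) (j : Fin (n + 1)) (F : (Fin (n + 2) → List ℂ) → M) :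
    evSum q (n + 1) w ξ (Fin.cons x t) j.succ F = ∑ p : Fin x.length,
        (x.get p * gFun q (x.get p) ξ * fProd q (x.eraseIdx p) [ξ]
          * (w 0 (x.get p) * fProd q [x.get p] (x.eraseIdx p))) •
        evSum q n (fun i => w i.succ) (x.get p) t j fun t' => F (Fin.cons (x.eraseIdx p) t') := rfl

theorem map_evSum (L : M →ₗ[ℂ] M') (q : ℂ) (n : ℕ) (w : Fin (n + 1) → ℂ → ℂ) (ξ : ℂ)
    (t : Fin (n + 1) → List ℂ) (j : Fin (n + 1)) (F : (Fin (n + 1) → List ℂ) → M) :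
    L (evSum q n w ξ t j F) = evSum q n w ξ t j fun t' => L (F t') := by
  induction n generalizing ξ with
  | zero => simp [evSum]
  | succ n ih =>
    refine Fin.cases ?_ (fun j => ?_) j
    · simp [evSum_zero]
    · simp only [evSum_succ, map_sum, map_smul, ih]

/-- The sum over one-element parts of all the sets of parameters but the last one. The function `F`
takes the element chosen in the first set and the remaining parameters. -/
noncomputable def fullSum (q : ℂ) : (n : ℕ) → (w : Fin (n + 1) → ℂ → ℂ) →
    (t : Fin (n + 1) → List ℂ) → (z : ℂ) → (F : ℂ → (Fin (n + 1) → List ℂ) → M) → M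
  | 0, _, t, z, F => F z t
  | n + 1, w, t, z, F => ∑ p : Fin (t 0).length,
      (w 0 ((t 0).get p) * fProd q [(t 0).get p] ((t 0).eraseIdx p)) •
        fullSum q n (fun i => w i.succ) (fun i => t i.succ) z fun y t' =>
          (gRight q y ((t 0).get p) * fProd q (t' 0) [(t 0).get p]) •
            F ((t 0).get p) (Fin.cons ((t 0).eraseIdx p) t')

/-- The sum over one-element parts of the sets of parameters from the `j`-th one on, without the
last one. -/
noncomputable def recSum (q : ℂ) : (n : ℕ) → (w : Fin (n + 1) → ℂ → ℂ) →
    (t : Fin (n + 1) → List ℂ) → (z : ℂ) → (j : Fin (n + 1)) →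
    (F : (Fin (n + 1) → List ℂ) → M) → M
  | 0, _, t, _, _, F => F t
  | n + 1, w, t, z, j, F => Fin.cases (fullSum q (n + 1) w t z fun _ => F)
      (fun j => recSum q n (fun i => w i.succ) (fun i => t i.succ) z j
        fun t' => F (Fin.cons (t 0) t')) j

theorem recSum_zero (q : ℂ) (n : ℕ) (w : Fin (n + 1) → ℂ → ℂ) (t : Fin (n + 1) → List ℂ) (z : ℂ)
    (F : (Fin (n + 1) → List ℂ) → M) : recSum q n w t z 0 F = fullSum q n w t z fun _ => F := by
  cases n <;> rfl

theorem recSum_succ (q : ℂ) (n : ℕ) (w : Fin (n + 2) → ℂ → ℂ) (t : Fin (n + 2) → List ℂ) (z : ℂ)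
    (j : Fin (n + 1)) (F : (Fin (n + 2) → List ℂ) → M) :
    recSum q (n + 1) w t z j.succ F = recSum q n (fun i => w i.succ) (fun i => t i.succ) z j
        fun t' => F (Fin.cons (t 0) t') := rfl

theorem fullSum_succ (q : ℂ) (n : ℕ) (w : Fin (n + 2) → ℂ → ℂ) (t : Fin (n + 2) → List ℂ) (z : ℂ)
    (F : ℂ → (Fin (n + 2) → List ℂ) → M) :
    fullSum q (n + 1) w t z F = ∑ p : Fin (t 0).length,
      (w 0 ((t 0).get p) * fProd q [(t 0).get p] ((t 0).eraseIdx p)) •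
        fullSum q n (fun i => w i.succ) (fun i => t i.succ) z fun y t' =>
          (gRight q y ((t 0).get p) * fProd q (t' 0) [(t 0).get p]) •
            F ((t 0).get p) (Fin.cons ((t 0).eraseIdx p) t') := rfl

theorem map_fullSum (L : M →ₗ[ℂ] M') (q : ℂ) (n : ℕ) (w : Fin (n + 1) → ℂ → ℂ)
    (t : Fin (n + 1) → List ℂ) (z : ℂ) (F : ℂ → (Fin (n + 1) → List ℂ) → M) :
    L (fullSum q n w t z F) = fullSum q n w t z fun y t' => L (F y t') := by
  induction n with
  | zero => rfl
  | succ n ih => simp only [fullSum_succ, map_sum, map_smul, ih]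

theorem map_recSum (L : M →ₗ[ℂ] M') (q : ℂ) (n : ℕ) (w : Fin (n + 1) → ℂ → ℂ)
    (t : Fin (n + 1) → List ℂ) (z : ℂ) (j : Fin (n + 1)) (F : (Fin (n + 1) → List ℂ) → M) :
    L (recSum q n w t z j F) = recSum q n w t z j fun t' => L (F t') := by
  induction n with
  | zero => rfl
  | succ n ih =>
    refine Fin.cases ?_ (fun j => ?_) j
    · simp only [recSum_zero, map_fullSum]
    · simp only [recSum_succ, ih]

theorem fullSum_add (q : ℂ) (n : ℕ) (w : Fin (n + 1) → ℂ → ℂ)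
    (t : Fin (n + 1) → List ℂ) (z : ℂ) (F G : ℂ → (Fin (n + 1) → List ℂ) → M) :
    fullSum q n w t z (fun y t' => F y t' + G y t') = fullSum q n w t z F + fullSum q n w t z G := by
  induction n with
  | zero => rfl
  | succ n ih => simp only [fullSum_succ, smul_add, ih, Finset.sum_add_distrib]

theorem recSum_add (q : ℂ) (n : ℕ) (w : Fin (n + 1) → ℂ → ℂ)
    (t : Fin (n + 1) → List ℂ) (z : ℂ) (j : Fin (n + 1)) (F G : (Fin (n + 1) → List ℂ) → M) :
    recSum q n w t z j (fun t' => F t' + G t') = recSum q n w t z j F + recSum q n w t z j G := by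
  induction n with
  | zero => rfl
  | succ n ih =>
    refine Fin.cases ?_ (fun j => ?_) j
    · simp only [recSum_zero, fullSum_add]
    · simp only [recSum_succ, ih]

theorem fullSum_smul (q : ℂ) (n : ℕ) (w : Fin (n + 1) → ℂ → ℂ)
    (t : Fin (n + 1) → List ℂ) (z : ℂ) (c : ℂ) (F : ℂ → (Fin (n + 1) → List ℂ) → M) :
    fullSum q n w t z (fun y t' => c • F y t') = c • fullSum q n w t z F :=
  (map_fullSum (c • LinearMap.id) q n w t z F).symm

theorem recSum_smul (q : ℂ) (n : ℕ) (w : Fin (n + 1) → ℂ → ℂ)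
    (t : Fin (n + 1) → List ℂ) (z : ℂ) (j : Fin (n + 1)) (c : ℂ)
    (F : (Fin (n + 1) → List ℂ) → M) :
    recSum q n w t z j (fun t' => c • F t') = c • recSum q n w t z j F :=
  (map_recSum (c • LinearMap.id) q n w t z j F).symm

theorem recSum_sum (q : ℂ) (n : ℕ) (w : Fin (n + 1) → ℂ → ℂ)
    (t : Fin (n + 1) → List ℂ) (z : ℂ) (j : Fin (n + 1)) {ι : Type*} (s : Finset ι)
    (F : ι → (Fin (n + 1) → List ℂ) → M) :
    recSum q n w t z j (fun t' => ∑ p ∈ s, F p t') = ∑ p ∈ s, recSum q n w t z j (F p) := by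
  classical
  induction s using Finset.induction_on with
  -- The empty sum is a multiple of an arbitrary term by the scalar `0`.
  | empty => simpa using recSum_smul q n w t z j 0 (fun _ => (0 : M))
  | insert a s ha ih => simp only [Finset.sum_insert ha, recSum_add, ih]

/-- Only sublists of the original sets are ever substituted, so regularity of the parameters is
available when summands are compared. -/
theorem fullSum_congr (q : ℂ) (n : ℕ) (w : Fin (n + 1) → ℂ → ℂ)
    (t : Fin (n + 1) → List ℂ) (z : ℂ) {F G : ℂ → (Fin (n + 1) → List ℂ) → M}
    (h : ∀ y t', (∀ i, (t' i).Sublist (t i)) → F y t' = G y t') :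
    fullSum q n w t z F = fullSum q n w t z G := by
  induction n with
  | zero => exact h z t fun i => List.Sublist.refl _
  | succ n ih =>
    simp only [fullSum_succ]
    refine Finset.sum_congr rfl fun p _ => congrArg _ (ih _ _ fun y t' ht' => ?_)
    rw [h]
    exact Fin.cases (List.eraseIdx_sublist _ _) ht'

theorem recSum_congr (q : ℂ) (n : ℕ) (w : Fin (n + 1) → ℂ → ℂ)
    (t : Fin (n + 1) → List ℂ) (z : ℂ) (j : Fin (n + 1)) {F G : (Fin (n + 1) → List ℂ) → M}
    (h : ∀ t', (∀ i, (t' i).Sublist (t i)) → F t' = G t') :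
    recSum q n w t z j F = recSum q n w t z j G := by
  induction n with
  | zero => exact h t fun i => List.Sublist.refl _
  | succ n ih =>
    revert j
    refine Fin.cases ?_ (fun j => ?_)
    · simp only [recSum_zero]
      exact fullSum_congr _ _ _ _ _ fun _ => h
    · simp only [recSum_succ]
      refine ih _ _ _ fun t' ht' => h _ ?_
      exact Fin.cases (List.Sublist.refl _) ht'

/-- One step of the collapse: `x` is the element chosen in the current set, `y` that of the next
one. The two terms correspond to `x` being removed by the recursion or by the additional site `ξ`.
-/
theorem gRight_add_gFun (q : ℂ) {x ξ : ℂ} (z y : ℂ) (h : x ≠ ξ) :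
    gRight q y x + x * gFun q x ξ * ((z - x) / (y - x))
      = (z - ξ) / (x - ξ) * gRight q y x := by
  have h1 := sub_ne_zero.2 h
  simp only [gRight, gFun, div_eq_mul_inv]
  generalize (y - x)⁻¹ = r
  field_simp
  ring

/-- The sums over the parts before and after the `j`-th set add up to a single sum. -/
theorem sum_recSum_evSum (q : ℂ) (n : ℕ) (w : Fin (n + 1) → ℂ → ℂ) (t : Fin (n + 1) → List ℂ)
    {S : Set ℂ} (ht : RegularParams S t) (z ξ : ℂ) (hz : ∀ i, z ∉ t i) (hξ : ∀ i, ξ ∉ t i)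
    (hzξ : z ≠ ξ) (G : (Fin (n + 1) → List ℂ) → M) :
    ∑ j, recSum q n w t z j (fun t' => evSum q n w ξ t' j G)
      = fullSum q n w t z fun y t' => ((z - ξ) / (y - ξ) * fProd q (t' 0) [ξ]) • G t' := by
  induction n generalizing S ξ with
  | zero =>
    simp [recSum, evSum, fullSum, div_self (sub_ne_zero.2 hzξ)]
  | succ n ih =>
    rw [Fin.sum_univ_succ]
    simp only [recSum_zero, evSum_zero, recSum_succ, evSum_cons_succ, recSum_sum, recSum_smul]
    rw [Finset.sum_comm]
    simp only [← Finset.smul_sum]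
    rw [fullSum_succ, fullSum_succ, ← Finset.sum_add_distrib]
    refine Finset.sum_congr rfl fun p _ => ?_
    have hp : (t 0).get p ∈ t 0 := List.get_mem _ _
    -- For `j > 0` the element chosen in the first set plays the role of `ξ` for the remaining sets.
    rw [ih (fun i => w i.succ) (fun i => t i.succ) ht.tail _ (fun i => hz i.succ)
      (fun i hi => Fin.succ_ne_zero i (ht.2.2 _ _ _ hi hp))
      (ne_of_mem_of_not_mem hp (hz 0)).symm]
    rw [mul_comm (_ * fProd q ((t 0).eraseIdx p) [ξ]),
      mul_smul _ ((t 0).get p * _ * _), ← smul_add]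
    congr 1
    rw [← fullSum_smul, ← fullSum_add]
    congr 1
    ext y t'
    simp only [smul_smul, ← add_smul, Fin.cons_zero]
    congr 1
    have := gRight_add_gFun q z y (ne_of_mem_of_not_mem hp (hξ 0))
    linear_combination (fProd q (t' 0) [(t 0).get p] * fProd q ((t 0).eraseIdx p) [ξ]) * this

end sums

/-! ### The recursion without normalisation -/

section recursion
variable {H : Type*} [AddCommGroup H] [Module ℂ H] {q : ℂ} {S : Set ℂ}

theorem extract_bHat {n : ℕ} (hq : q ≠ 0)
    {T : ℂ → Matrix (Fin (n + 2)) (Fin (n + 2)) (Module.End ℂ H)} (hT : IsMonodromy q S T)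
    {lam : Fin (n + 2) → ℂ → ℂ} {vac : H} (hvac : IsPseudovacuum S T lam vac) (x : List ℂ)
    (hx : ∀ a ∈ x, a ∈ S) (hnd : x.Nodup) (p : Fin x.length) (t : Fin n → List ℂ)
    (ht : ∀ i, ∀ a ∈ t i, a ∈ S ∧ a ∉ x) :
    extract q (block T) x p (bHat q n (chain q (block T) x) (nestedVac n x.length vac) t)
      = (lam 1 (x.get p) * fProd q [x.get p] (x.eraseIdx p)) •
        bHat q n (leftR q (chain q (block T) (x.eraseIdx p)) (x.get p))
          (siteZero n _ (nestedVac n (x.eraseIdx p).length vac)) t := by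
  rw [bHat_intertwine q n
    (T' := leftR q (chain q (block T) (x.eraseIdx p)) (x.get p)) (extract q (block T) x p) t
    (fun i u hu a b w => extract_intertwine hq (isMonodromy_block hT) x hx hnd p (ht i u hu).1
      (ht i u hu).2 a b w), extract_nestedVac hvac x hx p, bHat_smul]
  rfl

/-- On an additional site in its first state, the lower right block of `leftR` acts as that of `T`:
the diagonal entry is `1` and the swap term reads a zero component. The nested levels thus do not
see the site, and only the outermost row product does. -/
theorem bHat_leftR {n : ℕ} (ξ : ℂ)
    (T : ℂ → Matrix (Fin (n + 2)) (Fin (n + 2)) (Module.End ℂ H)) (vac : H)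
    (t : Fin (n + 1) → List ℂ) :
    bHat q (n + 1) (leftR q T ξ) (siteZero (n + 1) H vac) t
      = bRow (leftR q T ξ) (t 0) ((siteZero (n + 1) H).compLeft _
        (bHat q n (chain q (block T) (t 0)) (nestedVac n (t 0).length vac) fun i => t i.succ)) := by
  rw [bHat, ← compLeft_nestedVac]
  congr 1
  refine (bHat_intertwine q n _ _ (fun i u hu a b w => ?_) _).symm
  refine chain_intertwine q (D := block T) (D' := block (leftR q T ξ)) _ (fun i' j' w' => ?_) _ _ _ _
  ext k
  change _ = leftR q T ξ u i'.succ j'.succ (siteZero (n + 1) H w') k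
  rw [leftR_apply]
  refine Fin.cases ?_ (fun k => ?_) k <;> simp [siteZero, rDiag, block]

/-- The components of the Bethe vector of a monodromy matrix with one additional site. -/
theorem bHat_leftR_apply {n : ℕ} (hq : q ≠ 0)
    {T : ℂ → Matrix (Fin (n + 2)) (Fin (n + 2)) (Module.End ℂ H)} (hT : IsMonodromy q S T)
    {lam : Fin (n + 2) → ℂ → ℂ} {vac : H} (hvac : IsPseudovacuum S T lam vac)
    {t : Fin (n + 1) → List ℂ} (ht : RegularParams S t) {ξ : ℂ} (hξ : ∀ i, ξ ∉ t i)
    (j : Fin (n + 1)) :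
    bHat q (n + 1) (leftR q T ξ) (siteZero (n + 1) H vac) t j.castSucc
      = evSum q n (fun i => lam i.succ) ξ t j (bHat q (n + 1) T vac) := by
  induction n generalizing H S ξ with
  | zero =>
    rw [bHat_leftR, Fin.eq_zero j, evSum_zero]
    exact bRow_leftR_zero q ξ T (t 0) _
  | succ n ih =>
    rw [bHat_leftR]
    refine Fin.cases ?_ (fun j => ?_) j
    · rw [evSum_zero]
      exact bRow_leftR_zero q ξ T (t 0) _
    -- Extracting the site of `x_p` produces a nested vector with `x_p` as its own additional site,
    -- so the inductive hypothesis applies with `ξ` replaced by `x_p`.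
    · rw [← Fin.succ_castSucc, bRow_leftR_succ hq hT _ (ht.1 0) (ht.2.1 0) (hξ 0), evSum_succ]
      refine Finset.sum_congr rfl fun p _ => ?_
      have hsub : {u ∈ S | u ∉ t 0} ⊆ {u ∈ S | u ∉ (t 0).eraseIdx p} :=
        fun u hu => ⟨hu.1, fun h => hu.2 (List.mem_of_mem_eraseIdx h)⟩
      rw [extract_bHat hq hT hvac _ (ht.1 0) (ht.2.1 0) p _ ht.tail.1, Pi.smul_apply, map_smul,
        ih (isMonodromy_chain hq (isMonodromy_block hT) ((t 0).eraseIdx p))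
          ((isPseudovacuum_chain hvac ((t 0).eraseIdx p)).mono fun u hu => hu.1)
          (ht.tail.mono hsub)
          (fun i hi => Fin.succ_ne_zero i (ht.2.2 _ _ _ hi (List.get_mem _ _))),
        map_evSum, smul_smul]
      rfl

theorem addLast_succ_zero {n : ℕ} (t : Fin (n + 2) → List ℂ) (z : ℂ) : addLast t z 0 = t 0 := by
  simp [addLast, Function.update_of_ne, Fin.ext_iff]

theorem addLast_succ {n : ℕ} (t : Fin (n + 2) → List ℂ) (z : ℂ) :
    (fun i : Fin (n + 1) => addLast t z i.succ) = addLast (fun i => t i.succ) z := by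
  ext1 i
  simp only [addLast, Function.update_apply, ← Fin.succ_last, Fin.succ_inj]

/-- The recursion with respect to an element of the last set of parameters, for the Bethe vector
without its normalisation factor. -/
theorem bHat_addLast {n : ℕ} (hq : q ≠ 0)
    {T : ℂ → Matrix (Fin (n + 2)) (Fin (n + 2)) (Module.End ℂ H)} (hT : IsMonodromy q S T)
    {lam : Fin (n + 2) → ℂ → ℂ} {vac : H} (hvac : IsPseudovacuum S T lam vac)
    (t : Fin (n + 1) → List ℂ) (z : ℂ) (ht : RegularParams S (addLast t z)) :
    bHat q (n + 1) T vac (addLast t z) = ∑ j : Fin (n + 1), T z j.castSucc (Fin.last (n + 1))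
      (recSum q n (fun i => lam i.succ) t z j (bHat q (n + 1) T vac)) := by
  induction n generalizing H S with
  | zero =>
    have h0 : addLast t z = Fin.cons (z :: t 0) Fin.elim0 := by
      ext1 i
      rw [Fin.eq_zero i]
      rfl
    have h1 : t = Fin.cons (t 0) Fin.elim0 := by
      ext1 i
      rw [Fin.eq_zero i]
      rfl
    rw [h0, bHat_cons, Fin.sum_univ_one]
    refine (bRow_cons T z (t 0) _).trans ?_
    rw [Fin.sum_univ_one]
    change _ = T z 0 1 (bHat q 1 T vac t)
    conv_rhs => rw [h1, bHat_cons]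
    refine congrArg (fun v => T z 0 1 (bRow T (t 0) v)) ?_
    -- With one colour, every nested site is one-dimensional and the sum over row indices has a
    -- single term.
    exact (slice_nestedVac (n := 0) (t 0).length vac 0).trans (if_pos rfl)
  | succ n ih =>
    have htail := ht.tail
    rw [addLast_succ_zero, addLast_succ] at htail
    have hx : ∀ a ∈ t 0, a ∈ S := fun a ha => ht.1 0 a (by rwa [addLast_succ_zero])
    have hnd : (t 0).Nodup := by simpa only [addLast_succ_zero] using ht.2.1 0
    have hsubl : ∀ i, (t i).Sublist (addLast t z i) := by
      intro i
      unfold addLast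
      rcases eq_or_ne i (Fin.last (n + 1)) with rfl | hi
      · rw [Function.update_self]
        exact List.sublist_cons_self _ _
      · rw [Function.update_of_ne hi]
    have ht' := ht.sublist hsubl
    have hzl : z ∈ addLast t z (Fin.last (n + 1)) := by simp [addLast]
    have hzS : z ∈ S := ht.1 _ _ hzl
    have hz : ∀ i, z ∉ t i := by
      intro i hi
      have h1 := ht.2.2 _ _ z hzl ((hsubl i).subset hi)
      subst h1
      have h2 := ht.2.1 (Fin.last (n + 1))
      rw [addLast, Function.update_self] at h2
      exact (List.nodup_cons.1 h2).1 hi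
    rw [Fin.sum_univ_succ, bHat, addLast_succ, addLast_succ_zero,
      ih (isMonodromy_chain hq (isMonodromy_block hT) (t 0))
        ((isPseudovacuum_chain hvac (t 0)).mono fun u hu => hu.1) _ htail, map_sum]
    rw [← Fin.succ_last]
    -- The entry at `z` is carried through the operators of the first set; the two families of terms
    -- are treated separately below.
    simp only [← Fin.succ_castSucc, bRow_chain hT (t 0) hx hnd hzS (hz 0)]
    rw [Finset.sum_add_distrib, add_comm, ← map_sum]
    congr 1
    · rw [Fin.castSucc_zero, recSum_zero, fullSum_succ, Finset.sum_comm]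
      refine congrArg _ (Finset.sum_congr rfl fun p _ => ?_)
      have hp : (t 0).get p ∈ t 0 := List.get_mem _ _
      have hzp : z ≠ (t 0).get p := (ne_of_mem_of_not_mem hp (hz 0)).symm
      have hsub : {u ∈ S | u ∉ t 0} ⊆ {u ∈ S | u ∉ (t 0).eraseIdx p} :=
        fun u hu => ⟨hu.1, fun h => hu.2 (List.mem_of_mem_eraseIdx h)⟩
      set G : (Fin (n + 1) → List ℂ) → H := fun t' =>
        bHat q (n + 2) T vac (Fin.cons ((t 0).eraseIdx p) t') with hG
      -- The weights of the inductive hypothesis are the original eigenvalues: the nesting modifies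
      -- only `λ_2`, which is not attached to any of the remaining colours. Hence both sums can be
      -- written with the same weights.
      have key : ∀ j : Fin (n + 1), bRow T ((t 0).eraseIdx p) (extract q (block T) (t 0) p
          (recSum q n (fun i => nestedLam q lam (t 0) i.succ) (fun i => t i.succ) z j
            (bHat q (n + 1) (chain q (block T) (t 0)) (nestedVac (n + 1) (t 0).length vac)))
            j.castSucc)
          = (lam 1 ((t 0).get p) * fProd q [(t 0).get p] ((t 0).eraseIdx p)) •
            recSum q n (fun i => lam i.succ.succ) (fun i => t i.succ) z j fun t' =>
              evSum q n (fun i => lam i.succ.succ) ((t 0).get p) t' j G := by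
        intro j
        have h1 := map_recSum (bRow T ((t 0).eraseIdx p) ∘ₗ LinearMap.proj j.castSucc ∘ₗ
          extract q (block T) (t 0) p) q n (fun i => nestedLam q lam (t 0) i.succ)
          (fun i => t i.succ) z j
          (bHat q (n + 1) (chain q (block T) (t 0)) (nestedVac (n + 1) (t 0).length vac))
        refine h1.trans ?_
        rw [← recSum_smul]
        refine recSum_congr _ _ _ _ _ _ fun t' hsl => ?_
        have hreg := ht'.tail.sublist hsl
        simp only [LinearMap.comp_apply, LinearMap.proj_apply]
        rw [extract_bHat hq hT hvac _ hx hnd p _ hreg.1, Pi.smul_apply, map_smul,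
          bHat_leftR_apply hq (isMonodromy_chain hq (isMonodromy_block hT) ((t 0).eraseIdx p))
          ((isPseudovacuum_chain hvac ((t 0).eraseIdx p)).mono fun u hu => hu.1)
          (hreg.mono hsub) (fun i hi => (hreg.1 i _ hi).2 hp), map_evSum]
        rfl
      simp only [key]
      rw [← Finset.smul_sum, ← Finset.smul_sum, sum_recSum_evSum q n _ _ ht'.tail z _
        (fun i => hz i.succ) (fun i hi => Fin.succ_ne_zero i (ht'.2.2 _ _ _ hi hp)) hzp,
        smul_comm, ← fullSum_smul]
      change _ = (lam 1 ((t 0).get p) * fProd q [(t 0).get p] ((t 0).eraseIdx p)) • _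
      congr 1
      congr 1
      ext1 y
      ext1 t'
      rw [smul_smul]
      congr 1
      -- The factor `(z - ξ) / (y - ξ)` left by the collapse changes `g^{(r)}(z, ξ)` into
      -- `g^{(r)}(y, ξ)`.
      have h3 := sub_ne_zero.2 hzp
      simp only [gRight, gFun, div_eq_mul_inv]
      field_simp
    · refine Finset.sum_congr rfl fun j _ => ?_
      rw [recSum_succ, map_recSum]
      rfl

end recursion

/-! ### Independence of the order of the parameters -/

section symmetry
variable {H : Type*} [AddCommGroup H] [Module ℂ H] {q : ℂ} {S : Set ℂ}

theorem sum_comm_four {n : ℕ} {M : Type*} [AddCommMonoid M]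
    (g : Fin n → Fin n → Fin n → Fin n → M) :
    ∑ k, ∑ j, ∑ j', ∑ k', g k j j' k' = ∑ j', ∑ k', ∑ j, ∑ k, g k j j' k' := by
  have h1 : ∑ k, ∑ j, ∑ j', ∑ k', g k j j' k'
      = ∑ t : Fin n × Fin n × Fin n × Fin n, g t.1 t.2.1 t.2.2.1 t.2.2.2 := by
    simp only [Fintype.sum_prod_type]
  have h2 : ∑ j', ∑ k', ∑ j, ∑ k, g k j j' k'
      = ∑ t : Fin n × Fin n × Fin n × Fin n, g t.2.2.2 t.2.2.1 t.1 t.2.1 := by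
    simp only [Fintype.sum_prod_type]
  rw [h1, h2]
  exact Fintype.sum_equiv
    { toFun := fun t => (t.2.2.1, t.2.2.2, t.2.1, t.1)
      invFun := fun t => (t.2.2.2, t.2.2.1, t.1, t.2.1)
      left_inv := fun _ => rfl
      right_inv := fun _ => rfl } _ _ fun t => rfl

/-- The operator that exchanges the first two sites of a chain. -/
noncomputable def swapSites {n r : ℕ} (q a b : ℂ) :
    ((Fin (r + 2) → Fin n) → H) →ₗ[ℂ] ((Fin (r + 2) → Fin n) → H) :=
  unslice fun k => unslice fun j => (fFun q a b)⁻¹ • ∑ j', ∑ k',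
    rMatrix n q a b (j, k) (j', k') • (slice k' ∘ₗ slice j')

theorem slice_swapSites {n r : ℕ} (q a b : ℂ) (j k : Fin n) (ψ : (Fin (r + 2) → Fin n) → H) :
    slice j (slice k (swapSites q a b ψ)) = (fFun q a b)⁻¹ • ∑ j', ∑ k',
      rMatrix n q a b (j, k) (j', k') • slice k' (slice j' ψ) := by
  rw [swapSites, slice_unslice, slice_unslice]
  simp [LinearMap.sum_apply]

/-- The `R`-matrix multiplies a pair of first states by `f`; this fixes the normalisation of
`swapSites`. -/
theorem swapSites_nestedVac {n r : ℕ} {a b : ℂ} (hf : fFun q a b ≠ 0) (vac : H) :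
    swapSites q a b (nestedVac n (r + 2) vac) = nestedVac n (r + 2) vac := by
  refine ext_slice fun k => ext_slice fun j => ?_
  rw [slice_swapSites]
  have h0 : ∀ j' k' : Fin (n + 1), slice k' (slice j' (nestedVac n (r + 2) vac))
      = if j' = 0 then (if k' = 0 then nestedVac n r vac else 0) else 0 := by
    intro j' k'
    rw [slice_nestedVac]
    by_cases h1 : j' = 0 <;> simp [slice_nestedVac, h1]
  simp only [h0]
  rw [sum_rMatrix_row q a b j k fun j' k' : Fin (n + 1) =>
    if j' = 0 then (if k' = 0 then nestedVac n r vac else 0) else 0]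
  by_cases hj : j = 0 <;> by_cases hk : k = 0 <;> simp [hj, hk, rDiag, rSwap, hf, smul_smul]

/-- For two first-row entries the exchange relation has the scalar `f` in place of one `R`-matrix,
and the normalisation of `swapSites` cancels it. -/
theorem bRow_swapSites {n : ℕ}
    {T : ℂ → Matrix (Fin (n + 1)) (Fin (n + 1)) (Module.End ℂ H)} (hT : IsMonodromy q S T)
    {a b : ℂ} (ha : a ∈ S) (hb : b ∈ S) (hab : a ≠ b) (hf : fFun q a b ≠ 0) (x : List ℂ)
    (ψ : (Fin (x.length + 2) → Fin n) → H) :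
    bRow T (b :: a :: x) (swapSites q a b ψ) = bRow T (a :: b :: x) ψ := by
  have e1 : ∀ (c d : ℂ) (φ : (Fin (x.length + 2) → Fin n) → H), bRow T (c :: d :: x) φ
      = ∑ k, ∑ j, T c 0 k.succ (T d 0 j.succ (bRow T x (slice j (slice k φ)))) := by
    intro c d φ
    refine (bRow_cons T c (d :: x) φ).trans (Finset.sum_congr rfl fun k _ => ?_)
    rw [← map_sum]
    exact congrArg _ (bRow_cons T d x (slice k φ))
  rw [e1, e1]
  simp only [slice_swapSites, map_smul, map_sum]
  have e2 : ∀ j' k', ∑ j, ∑ k, rMatrix n q a b (j, k) (j', k') • T b 0 k.succ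
      (T a 0 j.succ (bRow T x (slice k' (slice j' ψ)))) =
      fFun q a b • T a 0 j'.succ (T b 0 k'.succ (bRow T x (slice k' (slice j' ψ)))) := by
    intro j' k'
    rw [exchange_row hT ha hb hab]
    simp [rDiag, rSwap]
  calc _ = ∑ j', ∑ k', (fFun q a b)⁻¹ • ∑ j, ∑ k, rMatrix n q a b (j, k) (j', k') • T b 0 k.succ
          (T a 0 j.succ (bRow T x (slice k' (slice j' ψ)))) := by
        simp only [Finset.smul_sum]
        exact sum_comm_four fun k j j' k' => (fFun q a b)⁻¹ • rMatrix n q a b (j, k) (j', k') •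
          T b 0 k.succ (T a 0 j.succ (bRow T x (slice k' (slice j' ψ))))
      _ = _ := by
        refine Finset.sum_congr rfl fun j' _ => Finset.sum_congr rfl fun k' _ => ?_
        rw [e2, smul_smul, inv_mul_cancel₀ hf, one_smul]

/-- The two outermost sites sit in adjacent `R`-matrices, so this is the Yang–Baxter equation; the
rest of the chain is a spectator. -/
theorem swapSites_chain {n : ℕ} (hq : q ≠ 0)
    (D : ℂ → Matrix (Fin n) (Fin n) (Module.End ℂ H)) {u a b : ℂ} (hua : u ≠ a) (hub : u ≠ b)
    (hab : a ≠ b) (x : List ℂ) (i m : Fin n) (ψ : (Fin (x.length + 2) → Fin n) → H) :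
    swapSites q a b (chain q D (a :: b :: x) u i m ψ : (Fin (x.length + 2) → Fin n) → H)
      = chain q D (b :: a :: x) u i m (swapSites q a b ψ) := by
  refine ext_slice fun k' => ext_slice fun j' => ?_
  have e1 : ∀ (c d : ℂ) (k j : Fin n) (φ : (Fin (x.length + 2) → Fin n) → H),
      slice (r := x.length) j (slice (r := x.length + 1) k (chain q D (c :: d :: x) u i m φ))
      = ∑ l, ∑ s, rMatrix n q u c (l, k) (m, s) • ∑ l', ∑ s', rMatrix n q u d (l', j) (l, s') •
        chain q D x u i l' (slice s' (slice s φ)) := by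
    intro c d k j φ
    refine (congrArg _ (chain_cons q D c (d :: x) u i m k φ)).trans ?_
    simp only [map_sum, map_smul]
    refine Finset.sum_congr rfl fun l _ => Finset.sum_congr rfl fun s _ => ?_
    exact congrArg _ (chain_cons q D d x u i l j (slice s φ))
  rw [slice_swapSites, e1]
  simp only [e1, slice_swapSites, map_smul, map_sum, Finset.smul_sum, smul_smul]
  have h1 : ∀ g : Fin n → Fin n → Fin n → Fin n → Fin n → Fin n → (Fin x.length → Fin n) → H,
      ∑ j, ∑ k, ∑ c, ∑ s, ∑ d, ∑ e, g j k c s d e = ∑ j, ∑ k, ∑ s, ∑ c, ∑ d, ∑ e, g j k c s d e :=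
    fun g => Finset.sum_congr rfl fun j _ => Finset.sum_congr rfl fun k _ => Finset.sum_comm
  rw [h1, sum_six_right' (fun j k s c d e => (fFun q a b)⁻¹ * (rMatrix n q a b (j', k') (j, k) *
      (rMatrix n q u a (c, j) (m, s) * rMatrix n q u b (d, k) (c, e))))
    fun d s e => chain q D x u i d (slice e (slice s ψ))]
  rw [sum_six_right' (fun c k d j s e => rMatrix n q u b (c, k') (m, k) *
      (rMatrix n q u a (d, j') (c, j) * ((fFun q a b)⁻¹ * rMatrix n q a b (j, k) (s, e))))
    fun s d e => chain q D x u i d (slice e (slice s ψ))]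
  refine Finset.sum_congr rfl fun e _ => ?_
  rw [Finset.sum_comm]
  refine Finset.sum_congr rfl fun s _ => Finset.sum_congr rfl fun d _ => ?_
  congr 1
  have := congrArg ((fFun q a b)⁻¹ * ·) (yangBaxter hq hua hub hab d j' k' m s e)
  simp only [Finset.mul_sum] at this
  refine Eq.trans ?_ (this.symm.trans ?_)
  · refine ((Finset.sum_congr rfl fun k _ => Finset.sum_comm).trans Finset.sum_comm).trans ?_
    refine Finset.sum_congr rfl fun _ _ => Finset.sum_congr rfl fun _ _ =>
      Finset.sum_congr rfl fun _ _ => by ring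
  · refine (Finset.sum_comm.trans
      ((Finset.sum_congr rfl fun k _ => Finset.sum_comm).trans Finset.sum_comm)).trans ?_
    refine Finset.sum_congr rfl fun _ _ => Finset.sum_congr rfl fun _ _ =>
      Finset.sum_congr rfl fun _ _ => by ring

/-- Chains with reordered sites are intertwined by an operator that preserves the pseudovacuum and
the products of entries of the first row. -/
theorem exists_reorder {n : ℕ} (hq : q ≠ 0)
    {T : ℂ → Matrix (Fin (n + 2)) (Fin (n + 2)) (Module.End ℂ H)} (hT : IsMonodromy q S T)
    {x y : List ℂ} (h : x.Perm y) (hx : ∀ a ∈ x, a ∈ S) (hnd : x.Nodup)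
    (hf : ∀ a ∈ x, ∀ b ∈ x, a ≠ b → fFun q a b ≠ 0) :
    ∃ L : ((Fin x.length → Fin (n + 1)) → H) →ₗ[ℂ] ((Fin y.length → Fin (n + 1)) → H),
      (∀ u, u ∉ x → ∀ i j ψ, L (chain q (block T) x u i j ψ) = chain q (block T) y u i j (L ψ)) ∧
      (∀ vac, L (nestedVac n x.length vac) = nestedVac n y.length vac) ∧
      ∀ ψ, bRow T y (L ψ) = bRow T x ψ := by
  induction h with
  | nil => exact ⟨LinearMap.id, fun _ _ _ _ _ => rfl, fun _ => rfl, fun _ => rfl⟩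
  | @cons a x y h ih =>
    obtain ⟨L, h1, h2, h3⟩ := ih (fun b hb => hx b (by simp [hb])) (List.nodup_cons.1 hnd).2
      fun b hb c hc => hf b (by simp [hb]) c (by simp [hc])
    refine ⟨unslice (r := y.length) fun k => L ∘ₗ slice (r := x.length) k, ?_, ?_, ?_⟩
    · intro u hu i j ψ
      have hu' := List.ne_and_not_mem_of_not_mem_cons hu
      refine ext_slice (r := y.length) fun k => ?_
      refine (slice_unslice _ _ _).trans ?_
      refine Eq.trans ?_ (chain_cons q (block T) a y u i j k _).symm
      simp only [slice_unslice, LinearMap.comp_apply, chain_cons, map_sum, map_smul, h1 u hu'.2]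
    · intro vac
      refine ext_slice (r := y.length) fun k => ?_
      refine (slice_unslice _ _ _).trans ?_
      refine Eq.trans ?_ (slice_nestedVac y.length vac k).symm
      refine (congrArg L (slice_nestedVac x.length vac k)).trans ?_
      split_ifs
      · exact h2 vac
      · exact map_zero L
    · intro ψ
      refine (bRow_cons T a y _).trans (Eq.trans ?_ (bRow_cons T a x ψ).symm)
      simp only [slice_unslice, LinearMap.comp_apply, h3]
  | swap a b x =>
    have hab : b ≠ a := fun h => by simp [h] at hnd
    have hfab := hf b (by simp) a (by simp) hab
    refine ⟨swapSites (r := x.length) q b a, ?_, ?_, ?_⟩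
    · intro u hu i j ψ
      simp only [List.mem_cons, not_or] at hu
      exact swapSites_chain hq (block T) hu.1 hu.2.1 hab x i j ψ
    · exact fun vac => swapSites_nestedVac hfab vac
    · exact fun ψ => bRow_swapSites hT (hx b (by simp)) (hx a (by simp)) hab hfab x ψ
  | @trans x y w hxy hyw ih1 ih2 =>
    obtain ⟨L, h1, h2, h3⟩ := ih1 hx hnd hf
    obtain ⟨L', h1', h2', h3'⟩ := ih2 (fun a ha => hx a (hxy.mem_iff.2 ha)) (hxy.nodup_iff.1 hnd)
      fun a ha b hb => hf a (hxy.mem_iff.2 ha) b (hxy.mem_iff.2 hb)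
    refine ⟨L' ∘ₗ L, fun u hu i j ψ => ?_, fun vac => ?_, fun ψ => ?_⟩
    · rw [LinearMap.comp_apply, h1 u hu, h1' u fun h => hu (hxy.mem_iff.2 h)]
      rfl
    · rw [LinearMap.comp_apply, h2, h2']
    · rw [LinearMap.comp_apply, h3', h3]

/-- Bethe vectors do not depend on the order of the parameters in each set. -/
theorem bHat_perm {N : ℕ} (hq : q ≠ 0)
    {T : ℂ → Matrix (Fin (N + 1)) (Fin (N + 1)) (Module.End ℂ H)} (hT : IsMonodromy q S T)
    (vac : H) {t t' : Fin N → List ℂ} (h : ∀ i, (t i).Perm (t' i)) (ht : RegularParams S t)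
    (hf : ∀ i, ∀ a ∈ t i, ∀ b ∈ t i, a ≠ b → fFun q a b ≠ 0) :
    bHat q N T vac t = bHat q N T vac t' := by
  induction N generalizing H S with
  | zero => rfl
  | succ N ih =>
    obtain ⟨L, h1, h2, h3⟩ := exists_reorder hq hT (h 0) (ht.1 0) (ht.2.1 0) (hf 0)
    rw [bHat, bHat, ← h3, bHat_intertwine q N L _ (fun i u hu a b w => h1 u (ht.tail.1 i u hu).2 a b w),
      h2]
    congr 1
    refine ih (isMonodromy_chain hq (isMonodromy_block hT) (t' 0)) _ (fun i => h i.succ)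
      (ht.tail.mono fun u hu => ⟨hu.1, fun hm => hu.2 ((h 0).mem_iff.2 hm)⟩) fun i => hf i.succ

end symmetry

/-! ### Normalisation factors -/

section normalisation

/-- The normalisation factor of Bethe vectors, where `w i` is the eigenvalue attached to the `i`-th
colour. -/
noncomputable def bNorm (q : ℂ) {n : ℕ} (w : Fin (n + 1) → ℂ → ℂ) (t : Fin (n + 1) → List ℂ) : ℂ :=
  (∏ i, prodOver (w i) (t i)) * ∏ i : Fin n, fProd q (t i.succ) (t i.castSucc)

/-- The nested vector is normalised by `λ_3, λ_4, …`, which the nesting does not change, so the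
factors of all levels simply multiply. -/
theorem betheVector_eq_bHat {H : Type*} [AddCommGroup H] [Module ℂ H] (q : ℂ) (n : ℕ)
    (T : ℂ → Matrix (Fin (n + 2)) (Fin (n + 2)) (Module.End ℂ H)) (lam : Fin (n + 2) → ℂ → ℂ)
    (vac : H) (t : Fin (n + 1) → List ℂ) :
    betheVector q (n + 1) T lam vac t
      = (bNorm q (fun i => lam i.succ) t)⁻¹ • bHat q (n + 1) T vac t := by
  induction n generalizing H with
  | zero =>
    rw [betheVector, bRow_eq_sum]
    have h : (Fin.snoc t [] : Fin 2 → List ℂ) 1 = [] := rfl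
    have hn : bNorm q (fun i => lam i.succ) t = prodOver (lam 1) (t 0) := by simp [bNorm]
    simp only [h, fProd_nil_left, mul_one, hn]
    rfl
  | succ n ih =>
    rw [betheVector, bRow_eq_sum, nestedMonodromy_eq_chain, ih, map_smul, smul_smul, ← mul_inv]
    have : (Fin.snoc t [] : Fin (n + 3) → List ℂ) 1 = t 1 := by
      have h : (1 : Fin (n + 3)) = Fin.castSucc (1 : Fin (n + 2)) := rfl
      rw [h, Fin.snoc_castSucc]
    rw [this]
    congr 2
    unfold bNorm
    rw [Fin.prod_univ_succ (n := n + 1), Fin.prod_univ_succ (n := n)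
      fun i => fProd q (t i.succ) (t i.castSucc)]
    exact mul_mul_mul_comm _ _ _ _

theorem prodOver_ne_zero {φ : ℂ → ℂ} {x : List ℂ} (h : ∀ a ∈ x, φ a ≠ 0) : prodOver φ x ≠ 0 := by
  rw [prodOver, Ne, List.prod_eq_zero_iff]
  simpa using h

theorem bNorm_perm (q : ℂ) {n : ℕ} (w : Fin (n + 1) → ℂ → ℂ) {t t' : Fin (n + 1) → List ℂ}
    (h : ∀ i, (t i).Perm (t' i)) : bNorm q w t = bNorm q w t' := by
  unfold bNorm
  congr 1
  · exact Finset.prod_congr rfl fun i _ => prodOver_perm _ (h i)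
  · exact Finset.prod_congr rfl fun i _ => fProd_perm q (h _) (h _)

theorem IsGeneric.fFun_ne_zero {N : ℕ} {q : ℂ} {S : Set ℂ} {lam : Fin (N + 1) → ℂ → ℂ}
    {t : Fin N → List ℂ} (h : IsGeneric q S lam t) (i j : Fin N) (a b : ℂ) (ha : a ∈ t i)
    (hb : b ∈ t j) (hij : i ≠ j ∨ a ≠ b) : a ≠ b ∧ fFun q a b ≠ 0 := by
  have h2 := List.pairwise_flatten.1 h.2
  rw [List.pairwise_ofFn] at h2
  rcases lt_trichotomy i j with hlt | rfl | hlt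
  · have := h2.2 hlt a ha b hb
    exact ⟨this.1, this.2.1⟩
  · have h3 := h2.1 (t i) (by simp [List.mem_ofFn])
    have hab : a ≠ b := hij.resolve_left fun h => h rfl
    have : Std.Symm fun x y : ℂ => x ≠ y ∧ fFun q x y ≠ 0 ∧ fFun q y x ≠ 0 :=
      ⟨fun _ _ h => ⟨h.1.symm, h.2.2, h.2.1⟩⟩
    have := h3.forall ha hb hab
    exact ⟨this.1, this.2.1⟩
  · have := h2.2 hlt b hb a ha
    exact ⟨this.1.symm, this.2.2⟩

theorem IsGeneric.regularParams {N : ℕ} {q : ℂ} {S : Set ℂ} {lam : Fin (N + 1) → ℂ → ℂ}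
    {t : Fin N → List ℂ} (h : IsGeneric q S lam t) : RegularParams S t := by
  refine ⟨fun i a ha => (h.1 i a ha).1, fun i => ?_, fun i j a hi hj => ?_⟩
  · have h2 := (List.pairwise_flatten.1 h.2).1 (t i) (by simp [List.mem_ofFn])
    exact h2.imp fun hab => hab.1
  · by_contra hij
    exact (h.fFun_ne_zero i j a a hi hj (Or.inl hij)).1 rfl

theorem IsGeneric.bNorm_ne_zero {n : ℕ} {q : ℂ} {S : Set ℂ} {lam : Fin (n + 2) → ℂ → ℂ}
    {t : Fin (n + 1) → List ℂ} (h : IsGeneric q S lam t) :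
    bNorm q (fun i => lam i.succ) t ≠ 0 := by
  refine mul_ne_zero (Finset.prod_ne_zero_iff.2 fun i _ => prodOver_ne_zero fun a ha =>
    (h.1 i a ha).2) (Finset.prod_ne_zero_iff.2 fun i _ => prodOver_ne_zero fun a ha =>
    prodOver_ne_zero fun b hb => (h.fFun_ne_zero _ _ a b ha hb (Or.inl ?_)).2)
  exact (Fin.castSucc_lt_succ).ne'

end normalisation

/-! ### Sums over partitions -/

section partition
variable {n : ℕ}

theorem partI_last {t : Fin (n + 1) → List ℂ} {j : Fin (n + 1)} (z : ℂ) (p : ParamPartition t j) :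
    partI z p (Fin.last n) = z := by simp [partI]

theorem partII_last {t : Fin (n + 1) → List ℂ} {j : Fin (n + 1)} (p : ParamPartition t j) :
    partII p (Fin.last n) = t (Fin.last n) := by simp [partII]

theorem addLast_perm {t : Fin (n + 1) → List ℂ} {j : Fin (n + 1)} (z : ℂ) (p : ParamPartition t j)
    {i : Fin (n + 1)} (h : j ≤ i) : (addLast t z i).Perm (partI z p i :: partII p i) := by
  rcases eq_or_ne i (Fin.last n) with rfl | hi
  · rw [partI_last, partII_last, addLast, Function.update_self]
  · have h1 : j ≤ i ∧ i < Fin.last n := ⟨h, Fin.lt_last_iff_ne_last.2 hi⟩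
    rw [partI, partII, dif_pos h1, dif_pos h1, addLast, Function.update_of_ne hi]
    exact (List.getElem_cons_eraseIdx_perm (p ⟨i, h1⟩).2).symm

theorem addLast_eq_partII {t : Fin (n + 1) → List ℂ} {j : Fin (n + 1)} (z : ℂ)
    (p : ParamPartition t j) {i : Fin (n + 1)} (h : ¬j ≤ i) : addLast t z i = partII p i := by
  have hi : i ≠ Fin.last n := fun hi => h (hi ▸ Fin.le_last j)
  rw [partII, dif_neg fun h1 => h h1.1, addLast, Function.update_of_ne hi]

theorem addLast_castSucc (t : Fin (n + 1) → List ℂ) (z : ℂ) (i : Fin n) :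
    addLast t z i.castSucc = t i.castSucc := by
  rw [addLast, Function.update_of_ne (Fin.castSucc_lt_last i).ne]

/-- Each set from `j` on splits into its two parts. In `f(t^{ν+1}, t^ν)` the left argument is split
first, against the whole of `t^ν`, which gives the denominators of `recCoeff`; then the right one is
split against the second part of `t^{ν+1}`, which gives the factors present in `recSum`. -/
theorem bNorm_addLast (q : ℂ) (w : Fin (n + 1) → ℂ → ℂ) {t : Fin (n + 1) → List ℂ}
    {j : Fin (n + 1)} (z : ℂ) (p : ParamPartition t j) :
    bNorm q w (addLast t z) = bNorm q w (partII p) * w (Fin.last n) z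
      * (∏ ν : Fin n with j ≤ ν.castSucc, w ν.castSucc (partI z p ν.castSucc))
      * (∏ ν ∈ Finset.Ici j, fProd q [partI z p ν]
          ((Fin.cons [] fun i : Fin n => t i.castSucc : Fin (n + 1) → List ℂ) ν))
      * ∏ ν : Fin n with j ≤ ν.castSucc, fProd q (partII p ν.succ) [partI z p ν.castSucc] := by
  have h1 : ∀ i, prodOver (w i) (addLast t z i)
      = prodOver (w i) (partII p i) * if j ≤ i then w i (partI z p i) else 1 := by
    intro i
    split_ifs with h
    · rw [prodOver_perm _ (addLast_perm z p h), prodOver_cons, mul_comm]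
    · rw [addLast_eq_partII z p h, mul_one]
  have h2 : ∀ ν : Fin n, fProd q (addLast t z ν.succ) (addLast t z ν.castSucc)
      = fProd q (partII p ν.succ) (partII p ν.castSucc)
        * (if j ≤ ν.succ then fProd q [partI z p ν.succ] (t ν.castSucc) else 1)
        * (if j ≤ ν.castSucc then fProd q (partII p ν.succ) [partI z p ν.castSucc] else 1) := by
    intro ν
    have h3 : fProd q (addLast t z ν.succ) (addLast t z ν.castSucc)
        = fProd q (partII p ν.succ) (addLast t z ν.castSucc)
        * (if j ≤ ν.succ then fProd q [partI z p ν.succ] (t ν.castSucc) else 1) := by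
      split_ifs with h
      · rw [fProd_perm q (addLast_perm z p h) (List.Perm.refl _), fProd_cons_left,
          addLast_castSucc, mul_comm]
      · rw [addLast_eq_partII z p h, mul_one]
    have h4 : fProd q (partII p ν.succ) (addLast t z ν.castSucc)
        = fProd q (partII p ν.succ) (partII p ν.castSucc)
        * (if j ≤ ν.castSucc then fProd q (partII p ν.succ) [partI z p ν.castSucc] else 1) := by
      split_ifs with h
      · rw [fProd_perm q (List.Perm.refl _) (addLast_perm z p h), fProd_cons_right, mul_comm]
      · rw [addLast_eq_partII z p h, mul_one]
    rw [h3, h4]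
    ring
  -- The factor at `ν = 0` involves the empty set `t^0` and equals `1`, so the index can be shifted.
  have h5 : ∏ ν ∈ Finset.Ici j, fProd q [partI z p ν]
          ((Fin.cons [] fun i : Fin n => t i.castSucc : Fin (n + 1) → List ℂ) ν)
      = ∏ ν : Fin n, if j ≤ ν.succ then fProd q [partI z p ν.succ] (t ν.castSucc) else 1 := by
    have : Finset.Ici j = Finset.univ.filter (j ≤ ·) := by ext; simp
    rw [this, Finset.prod_filter, Fin.prod_univ_succ]
    simp only [Fin.cons_zero, Fin.cons_succ, fProd_nil_right, ite_self, one_mul]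
  simp only [bNorm, h1, h2, h5, Finset.prod_mul_distrib, Finset.prod_filter]
  rw [Fin.prod_univ_castSucc (f := fun i => if j ≤ i then w i (partI z p i) else 1), partI_last,
    if_pos (Fin.le_last j)]
  ring

/-- A choice in the first set of parameters and choices in the other sets. -/
def partitionZeroEquiv (t : Fin (n + 2) → List ℂ) :
    ParamPartition t 0 ≃ Fin (t 0).length × ParamPartition (fun i => t i.succ) 0 where
  toFun p := (p ⟨0, Fin.zero_le _, Fin.last_pos⟩,
    fun ν => p ⟨ν.1.succ, Fin.zero_le _, by simpa [← Fin.succ_last] using ν.2.2⟩)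
  invFun a ν := Fin.cases (motive := fun ν => 0 ≤ ν ∧ ν < Fin.last (n + 1) → Fin (t ν).length)
    (fun _ => a.1)
    (fun ν h => a.2 ⟨ν, Fin.zero_le _, by simpa [← Fin.succ_last] using h.2⟩) ν.1 ν.2
  left_inv p := by
    ext1 ⟨ν, h⟩
    induction ν using Fin.cases with
    | zero => rfl
    | succ ν => rfl
  right_inv a := rfl

/-- A choice in the sets of parameters from the second one on. -/
def partitionSuccEquiv (t : Fin (n + 2) → List ℂ) (j : Fin (n + 1)) :
    ParamPartition t j.succ ≃ ParamPartition (fun i => t i.succ) j where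
  toFun p ν := p ⟨ν.1.succ, Fin.succ_le_succ_iff.2 ν.2.1,
    by simpa [← Fin.succ_last] using ν.2.2⟩
  invFun a ν := Fin.cases (motive := fun ν => j.succ ≤ ν ∧ ν < Fin.last (n + 1) → Fin (t ν).length)
    (fun h => absurd h.1 (by simp))
    (fun ν h => a ⟨ν, Fin.succ_le_succ_iff.1 h.1, by simpa [← Fin.succ_last] using h.2⟩) ν.1 ν.2
  left_inv p := by
    ext1 ⟨ν, h⟩
    induction ν using Fin.cases with
    | zero => exact absurd h.1 (by simp)
    | succ ν => rfl
  right_inv a := rfl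

end partition

section partition
variable {n : ℕ} {M : Type*} [AddCommGroup M] [Module ℂ M]

/-- Unrolling of the recursion: the element handed on at each stage is the first part of the next
set, and the remaining parameters are the second parts. -/
theorem fullSum_eq_sum (q : ℂ) (w : Fin (n + 1) → ℂ → ℂ) (t : Fin (n + 1) → List ℂ) (z : ℂ)
    (F : ℂ → (Fin (n + 1) → List ℂ) → M) :
    fullSum q n w t z F = ∑ p : ParamPartition t 0,
      (∏ ν : Fin n, (gRight q (partI z p ν.succ) (partI z p ν.castSucc)
        * fProd q [partI z p ν.castSucc] (partII p ν.castSucc))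
        * (w ν.castSucc (partI z p ν.castSucc)
        * fProd q (partII p ν.succ) [partI z p ν.castSucc])) • F (partI z p 0) (partII p) := by
  induction n with
  | zero =>
    -- With one colour nothing is split, so there is exactly one partition.
    have : IsEmpty {ν : Fin 1 // 0 ≤ ν ∧ ν < Fin.last 0} :=
      ⟨fun ν => by have := ν.2.2; simp at this⟩
    rw [Fintype.sum_unique]
    simp only [Fin.prod_univ_zero, one_smul]
    have h1 : partI (t := t) (j := 0) z default 0 = z := partI_last z _
    have h2 : partII (t := t) (j := 0) default = t := by
      ext1 i
      rw [Fin.eq_zero i]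
      exact partII_last _
    rw [h1, h2]
    rfl
  | succ n ih =>
    rw [fullSum_succ]
    simp only [ih]
    rw [← (partitionZeroEquiv t).symm.sum_comp, Fintype.sum_prod_type]
    refine Finset.sum_congr rfl fun a _ => ?_
    rw [Finset.smul_sum]
    refine Finset.sum_congr rfl fun p _ => ?_
    set P := (partitionZeroEquiv t).symm (a, p)
    have hI0 : partI z P 0 = (t 0).get a := rfl
    have hI : ∀ ν, partI z P (Fin.succ ν) = partI z p ν := by
      intro ν
      simp only [partI, ← Fin.succ_last, Fin.succ_lt_succ_iff, Fin.zero_le, true_and]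
      rfl
    have hII0 : partII P 0 = (t 0).eraseIdx a := rfl
    have hII : ∀ ν, partII P (Fin.succ ν) = partII p ν := by
      intro ν
      simp only [partII, ← Fin.succ_last, Fin.succ_lt_succ_iff, Fin.zero_le, true_and]
      rfl
    have hP : partII P = Fin.cons ((t 0).eraseIdx a) (partII p) := by
      ext1 ν
      refine Fin.cases ?_ (fun ν => ?_) ν
      · exact hII0
      · exact hII ν
    rw [Fin.prod_univ_succ, hP]
    simp only [Fin.castSucc_zero, ← Fin.succ_castSucc, hI, hI0, Fin.cons_zero, Fin.cons_succ,
      smul_smul]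
    congr 1
    ring

theorem recSum_eq_sum (q : ℂ) (w : Fin (n + 1) → ℂ → ℂ) (t : Fin (n + 1) → List ℂ) (z : ℂ)
    (j : Fin (n + 1)) (F : (Fin (n + 1) → List ℂ) → M) :
    recSum q n w t z j F = ∑ p : ParamPartition t j,
      (∏ ν : Fin n with j ≤ ν.castSucc, (gRight q (partI z p ν.succ) (partI z p ν.castSucc)
        * fProd q [partI z p ν.castSucc] (partII p ν.castSucc))
        * (w ν.castSucc (partI z p ν.castSucc)
        * fProd q (partII p ν.succ) [partI z p ν.castSucc])) • F (partII p) := by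
  induction n with
  | zero =>
    rw [Fin.eq_zero j, recSum_zero, fullSum_eq_sum]
    simp
  | succ n ih =>
    revert j
    refine Fin.cases ?_ fun j => ?_
    · rw [recSum_zero, fullSum_eq_sum]
      simp
    rw [recSum_succ, ih, ← (partitionSuccEquiv t j).symm.sum_comp]
    refine Finset.sum_congr rfl fun p _ => ?_
    set P := (partitionSuccEquiv t j).symm p
    have hI : ∀ ν, partI z P (Fin.succ ν) = partI z p ν := by
      intro ν
      simp only [partI, ← Fin.succ_last, Fin.succ_lt_succ_iff, Fin.succ_le_succ_iff]
      rfl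
    have hII : ∀ ν, partII P (Fin.succ ν) = partII p ν := by
      intro ν
      simp only [partII, ← Fin.succ_last, Fin.succ_lt_succ_iff, Fin.succ_le_succ_iff]
      rfl
    have hP : partII P = Fin.cons (t 0) (partII p) := by
      ext1 ν
      refine Fin.cases ?_ (fun ν => ?_) ν
      · rw [partII, dif_neg fun h => absurd h.1 (by simp)]
        rfl
      · exact hII ν
    simp only [Finset.prod_filter]
    rw [Fin.prod_univ_succ, hP]
    simp only [Fin.castSucc_zero, ← Fin.succ_castSucc, hI, Fin.cons_succ, Fin.succ_le_succ_iff]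
    rw [if_neg (by simp), one_mul]

end partition

/-- Second recursion for Bethe vectors, with `N = n + 1` colours. The list `s i` is any enumeration
of the `i`-th set of parameters on the left-hand side. -/
theorem mainTheorem8 {H : Type*} [AddCommGroup H] [Module ℂ H] (n : ℕ) (q : ℂ) (hq : q ≠ 0)
    (S : Set ℂ) (T : ℂ → Matrix (Fin (n + 2)) (Fin (n + 2)) (Module.End ℂ H))
    (hT : IsMonodromy q S T) (lam : Fin (n + 2) → ℂ → ℂ) (vac : H)
    (hvac : IsPseudovacuum S T lam vac) (t : Fin (n + 1) → List ℂ) (z : ℂ)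
    (hgen : IsGeneric q S lam (addLast t z))
    (s : Fin (n + 1) → List ℂ) (hs : ∀ i, (s i).Perm (addLast t z i)) :
    betheVector q (n + 1) T lam vac s =
      ∑ j : Fin (n + 1), ∑ p : ParamPartition t j,
        recCoeff q z p •
          (lam (Fin.last (n + 1)) z)⁻¹ •
            T z j.castSucc (Fin.last (n + 1)) (betheVector q (n + 1) T lam vac (partII p)) := by
  have hreg := hgen.regularParams
  have hne := hgen.bNorm_ne_zero
  rw [betheVector_eq_bHat, bNorm_perm q _ hs,
    ← bHat_perm hq hT vac (fun i => (hs i).symm) hreg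
      fun i a ha b hb hab => (hgen.fFun_ne_zero i i a b ha hb (Or.inr hab)).2,
    bHat_addLast hq hT hvac t z hreg, Finset.smul_sum]
  refine Finset.sum_congr rfl fun j _ => ?_
  rw [recSum_eq_sum, map_sum, Finset.smul_sum]
  refine Finset.sum_congr rfl fun p _ => ?_
  rw [betheVector_eq_bHat, map_smul, map_smul, smul_smul, smul_smul, smul_smul]
  congr 1
  -- Genericity of the left-hand side makes every factor of the splitting nonzero, including the
  -- normalisation of the vector on the right. The eigenvalues and the factors `f` against the
  -- second parts then cancel the weights of `recSum`, and what remains is `recCoeff` together with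
  -- the inverse of the last eigenvalue at `z`.
  rw [bNorm_addLast q _ z p, Fin.succ_last] at hne ⊢
  simp only [mul_ne_zero_iff] at hne
  obtain ⟨⟨⟨⟨h1, h2⟩, h3⟩, h4⟩, h5⟩ := hne
  rw [recCoeff, Finset.prod_mul_distrib (s := Finset.univ.filter _), Finset.prod_mul_distrib
    (f := fun ν : Fin n => lam ν.castSucc.succ (partI z p ν.castSucc))]
  field_simp
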